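/- Let $F$ be a non-archimedean local field (of any characteristic) with ring of integers $\mathfrak{o}$ and finite residue field $\kappa$ of cardinality $q$, and let $E/F$ be a finite field extension with ring of integers $\mathcal{O}_E$, residue field $\kappa_E$ and a uniformizer $\pi_E$. An order of $E$ is a subring $R$ with $\mathfrak{o}\subset R\subset \mathcal{O}_E$ that spans $E$ over $F$; it is a local ring, with residue field denoted $\kappa_R$. Put $d_R=[\kappa_R:\kappa]$. An order is a Bass order if each of its ideals is generated by two elements. An overorder of $R$ is an order of $E$ containing $R$. A fractional $R$-ideal is a finitely generated $R$-submodule of $E$ that spans $E$ over $F$; let $X_R$ be the set of fractional $R$-ideals, on which $\Lambda_E=\pi_E^{\mathbb{Z}}$ acts by multiplication, and let $\overline{\mathrm{Cl}}(R)=E^\times\backslash X_R$ be the ideal class monoid. For an order $R'$ let $f(R')\ge 0$ be the integer such that $\{a\in\mathcal{O}_E : a\mathcal{O}_E\subset R'\}=\pi_E^{f(R')}\mathcal{O}_E$. Let $S(R)$ be the length of $\mathcal{O}_E/R$ as an $\mathfrak{o}$-module. Let $R$ be a Bass order of $E$. Then $[\kappa_E:\kappa_R]\in\{1,2\}$. There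 is a unique intermediate field $K$ of $E/F$ that is unramified over $F$ and has residue field $\kappa_R$ (inside $\kappa_E$); it satisfies $[K:F]=d_R$ and $\mathcal{O}_K\subset R$. Let $S_K(R)$ be the length of $\mathcal{O}_E/R$ as an $\mathcal{O}_K$-module. Then $S(R)$ and $S_K(R)$ are finite, $S(R)=d_R\,S_K(R)$, and $$\#(\Lambda_E\backslash X_R)=q^{S(R)}+[\kappa_E:\kappa_R]\cdot\sum_{i=0}^{S_K(R)-1}q^{\,i\,d_R} =q^{S(R)}+[\kappa_E:\kappa_R]\cdot\left(q^{S(R)-d_R}+q^{S(R)-2d_R}+\cdots+q^{d_R}+1\right)$$ (the sum in parentheses being empty when $R=\mathcal{O}_E$), and $$\#\overline{\mathrm{Cl}}(R)=S_K(R)+1=\frac{[\kappa_E:\kappa_R]\cdot f(R)}{2}+1 .$$ Moreover, every overorder $R'$ of $R$ is the subring of $\mathcal{O}_E$ generated by $R$ and $\pi_E^{f(R')}\mathcal{O}_E$; in particular it is determined by $f(R')$. -/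

import Mathlib

open ValuativeRel
open scoped Pointwise

namespace BassOrder

section

variable (F E : Type*) [Field F] [ValuativeRel F] [TopologicalSpace F]
  [IsNonarchimedeanLocalField F] [Field E] [ValuativeRel E] [TopologicalSpace E]
  [IsNonarchimedeanLocalField E] [Algebra F E] [ValuativeExtension F E]

/-- An order of `E` over `𝒪[F]`: a subring of `𝒪[E]` that contains `𝒪[F]` and spans `E` over `F`. -/
structure LocalOrder where
  toSubalgebra : Subalgebra 𝒪[F] E
  le_integers : ∀ x ∈ toSubalgebra, x ∈ 𝒪[E]
  span_eq_top : Submodule.span F (toSubalgebra : Set E) = ⊤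

variable {F E}

set_option linter.unusedSectionVars false in
theorem algebraMap_mem_integer_iff (a : F) : algebraMap F E a ∈ 𝒪[E] ↔ a ∈ 𝒪[F] := by
  have h := ValuativeExtension.vle_iff_vle (A := F) (B := E) a 1
  rw [map_one] at h
  rw [Valuation.mem_integer_iff, Valuation.mem_integer_iff]
  rw [Valuation.Compatible.vle_iff_le (v := valuation E),
    Valuation.Compatible.vle_iff_le (v := valuation F)] at h
  simpa using h

variable (F E) in
theorem continuous_algebraMap_field : Continuous (algebraMap F E) := by
  refine continuous_of_continuousAt_zero (algebraMap F E) ?_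
  rw [ContinuousAt, map_zero, (IsValuativeTopology.hasBasis_nhds_zero' F).tendsto_iff
    (IsValuativeTopology.hasBasis_nhds_zero' E)]
  intro γ hγ
  obtain ⟨p, hp0, hp1⟩ := Valuation.IsNontrivial.exists_lt_one (v := valuation F)
  have hlt : ∀ a b : F, valuation F a < valuation F b →
      valuation E (algebraMap F E a) < valuation E (algebraMap F E b) := by
    intro a b h
    rw [← ValuativeExtension.mapValueGroupWithZero_valuation,
      ← ValuativeExtension.mapValueGroupWithZero_valuation]
    exact ValuativeExtension.mapValueGroupWithZero_strictMono h
  have ht : valuation E (algebraMap F E p) < 1 := by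
    have := hlt p 1 (by simpa using hp1)
    simpa using this
  obtain ⟨n, hn⟩ := exists_pow_lt₀ ht (Units.mk0 γ hγ)
  refine ⟨valuation F p ^ n, pow_ne_zero _ (by simpa using hp0), fun x hx => ?_⟩
  have := hlt x (p ^ n) (by simpa using hx)
  simp only [map_pow] at this
  exact this.trans hn

namespace LocalOrder

variable (R : LocalOrder F E)

instance : CoeSort (LocalOrder F E) (Type _) := ⟨fun R => R.toSubalgebra⟩

theorem isOpen [FiniteDimensional F E] : IsOpen (R.toSubalgebra : Set E) := by
  let _ := IsTopologicalAddGroup.rightUniformSpace E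
  have := isUniformAddGroup_of_addCommGroup (G := E)
  have hc := continuous_algebraMap_field F E
  obtain ⟨p, hp0, hp1⟩ := Valuation.IsNontrivial.exists_lt_one (v := valuation F)
  have hp0' : p ≠ 0 := by simpa using hp0
  have hpE : algebraMap F E p ≠ 0 := by simpa using hp0'
  obtain ⟨t, htR, ht⟩ := Submodule.fg_span_iff_fg_span_finset_subset (R.toSubalgebra : Set E)
    |>.mp (IsNoetherian.noetherian (Submodule.span F (R.toSubalgebra : Set E)))
  rw [R.span_eq_top] at ht
  let g : (t → F) → E := fun c => ∑ i, algebraMap F E (c i) * i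
  have hg : Continuous g := by fun_prop
  let L : Set E := g '' Set.pi Set.univ fun _ => (𝒪[F] : Set F)
  have hF : IsCompact (𝒪[F] : Set F) := IsNonarchimedeanLocalField.isCompact_closedBall F 1
  have hL : IsCompact L := (isCompact_univ_pi fun _ => hF).image hg
  have hLR : L ⊆ R.toSubalgebra := by
    rintro _ ⟨c, hcc, rfl⟩
    refine sum_mem fun i _ => mul_mem ?_ (htR i.2)
    exact R.toSubalgebra.algebraMap_mem (⟨c i, hcc i trivial⟩ : 𝒪[F])
  have hcover : ⋃ n : ℕ, (fun x : E => algebraMap F E p ^ n * x) ⁻¹' L = Set.univ := by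
    refine Set.eq_univ_of_forall fun x => Set.mem_iUnion.mpr ?_
    have hx : x ∈ Submodule.span F (t : Set E) := ht ▸ Submodule.mem_top
    obtain ⟨c, rfl⟩ := Submodule.mem_span_finset'.mp hx
    have hex : ∀ i, ∃ n : ℕ, valuation F p ^ n * valuation F (c i) ≤ 1 := by
      intro i
      by_cases h : c i = 0
      · exact ⟨0, by simp [h]⟩
      have h' : (valuation F (c i))⁻¹ ≠ 0 := by simpa using h
      obtain ⟨n, hn⟩ := exists_pow_lt₀ hp1 (Units.mk0 _ h')
      refine ⟨n, ?_⟩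
      have := mul_le_mul_left hn.le (valuation F (c i))
      rwa [Units.val_mk0, inv_mul_cancel₀ (by simpa using h)] at this
    choose N hN using hex
    refine ⟨∑ i, N i, fun i => p ^ (∑ i, N i) * c i, fun i _ => ?_, ?_⟩
    · change valuation F _ ≤ 1
      rw [map_mul, map_pow]
      refine le_trans (mul_le_mul_left ?_ _) (hN i)
      exact pow_le_pow_right_of_le_one' hp1.le
        (Finset.single_le_sum (fun _ _ => Nat.zero_le _) (Finset.mem_univ i))
    · simp only [g, Finset.mul_sum, map_mul, map_pow, Algebra.smul_def, mul_assoc]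
  obtain ⟨n, x, hx⟩ := nonempty_interior_of_iUnion_of_closed
    (fun n => hL.isClosed.preimage (continuous_const_mul (algebraMap F E p ^ n))) hcover
  have hpn : algebraMap F E p ^ n ≠ 0 := pow_ne_zero _ hpE
  have hopen : IsOpen ((fun x : E => algebraMap F E p ^ n * x) ''
      interior ((fun x : E => algebraMap F E p ^ n * x) ⁻¹' L)) :=
    (Homeomorph.mulLeft₀ _ hpn).isOpenMap _ isOpen_interior
  refine AddSubgroup.isOpen_of_mem_nhds R.toSubalgebra.toSubring.toAddSubgroup
    (g := algebraMap F E p ^ n * x) ?_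
  refine Filter.mem_of_superset (hopen.mem_nhds ⟨x, hx, rfl⟩) ?_
  rintro _ ⟨y, hy, rfl⟩
  have hyL := interior_subset hy
  exact hLR hyL

/-- The inclusion of an order into the ring of integers of `E`. -/
def toIntegers : R →+* 𝒪[E] where
  toFun x := ⟨x, R.le_integers x x.2⟩
  map_one' := rfl
  map_mul' _ _ := rfl
  map_zero' := rfl
  map_add' _ _ := rfl

instance [FiniteDimensional F E] : IsLocalHom R.toIntegers := by
  refine ⟨fun x hx => ?_⟩
  let A : AddSubgroup 𝒪[E] := R.toIntegers.range.toAddSubgroup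
  have hA : IsOpen (A : Set 𝒪[E]) := by
    have : (A : Set 𝒪[E]) = Subtype.val ⁻¹' (R.toSubalgebra : Set E) := by
      ext y
      constructor
      · rintro ⟨z, rfl⟩
        exact z.2
      · intro hy
        exact ⟨⟨y, hy⟩, rfl⟩
    rw [this]
    exact R.isOpen.preimage continuous_subtype_val
  have : Finite (𝒪[E] ⧸ A) := AddSubgroup.quotient_finite_of_isOpen A hA
  have hfin : A.FiniteIndex := AddSubgroup.finiteIndex_of_finite_quotient
  obtain ⟨u, hu⟩ := hx
  let B := A.map (AddMonoidHom.mulLeft (u : 𝒪[E]))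
  have hBA : B ≤ A := by
    rintro _ ⟨_, ⟨z, rfl⟩, rfl⟩
    exact ⟨x * z, by rw [map_mul, ← hu]; rfl⟩
  have hidx : B.index = A.index := by
    refine AddSubgroup.index_map_of_bijective (f := AddMonoidHom.mulLeft (u : 𝒪[E])) ?_ A
    exact u.mulLeft_bijective
  have hrel : B.relIndex A = 1 := by
    have h := AddSubgroup.relIndex_mul_index hBA
    rw [hidx] at h
    exact Nat.eq_of_mul_eq_mul_right (Nat.pos_of_ne_zero hfin.index_ne_zero) (by simpa using h)
  have h1 : (1 : 𝒪[E]) ∈ B :=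
    AddSubgroup.relIndex_eq_one.mp hrel (⟨1, map_one _⟩ : (1 : 𝒪[E]) ∈ A)
  obtain ⟨_, ⟨z, rfl⟩, hz⟩ := h1
  refine IsUnit.of_mul_eq_one z ?_
  have hinj : Function.Injective R.toIntegers := fun a b h =>
    Subtype.ext (congrArg (fun y : 𝒪[E] => (y : E)) h)
  apply hinj
  rw [map_mul, ← hu, map_one]
  exact hz

instance [FiniteDimensional F E] : IsLocalRing R :=
  RingHom.domain_isLocalRing R.toIntegers

instance : IsLocalHom (algebraMap 𝒪[F] R) := by
  refine ⟨fun a ha => ?_⟩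
  have hne : (a : F) ≠ 0 := by
    intro h
    have : a = 0 := Subtype.ext h
    rw [this, map_zero] at ha
    exact not_isUnit_zero ha
  obtain ⟨b, hb⟩ := ha.exists_right_inv
  have hb' : algebraMap F E a * (b : E) = 1 := congrArg (fun y : R => (y : E)) hb
  have hbE : (b : E) = algebraMap F E (a : F)⁻¹ := by
    rw [map_inv₀]
    exact eq_inv_of_mul_eq_one_right hb'
  have hmem : (a : F)⁻¹ ∈ 𝒪[F] := by
    rw [← algebraMap_mem_integer_iff (E := E), ← hbE]
    exact R.le_integers _ b.2
  exact IsUnit.of_mul_eq_one ⟨_, hmem⟩ (Subtype.ext (mul_inv_cancel₀ hne))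

/-- `R` is a Bass order: every ideal of `R` is generated by two elements. -/
def IsBass : Prop := ∀ I : Ideal R, ∃ a b : R, I = Ideal.span {a, b}

/-- The conductor of `R`: the elements `a` of `𝒪[E]` with `a 𝒪[E] ⊆ R`,
i.e. the largest ideal of `𝒪[E]` contained in `R`. -/
def conductor : Ideal 𝒪[E] where
  carrier := {a | ∀ b : 𝒪[E], (a : E) * b ∈ R.toSubalgebra}
  zero_mem' b := by simp
  add_mem' {x y} hx hy b := by
    have := add_mem (hx b) (hy b)
    simpa [add_mul] using this
  smul_mem' c x hx b := by
    have := hx (c * b)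
    simpa [mul_comm, mul_left_comm] using this

/-- The exponent `f` for which the conductor is the `f`-th power of the maximal ideal of `𝒪[E]`. -/
noncomputable def conductorExponent : ℕ := sInf {k : ℕ | 𝓂[E] ^ k ≤ R.conductor}

/-- Fractional ideals of `R`: finitely generated `R`-submodules of `E` that span `E` over `F`. -/
def FracIdeal : Type _ :=
  {M : Submodule R E // M.FG ∧ Submodule.span F (M : Set E) = ⊤}

set_option linter.unusedSectionVars false in
theorem span_units_smul (u : Eˣ) (M : Submodule R E)
    (hM : Submodule.span F (M : Set E) = ⊤) :
    Submodule.span F ((u • M : Submodule R E) : Set E) = ⊤ := by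
  rw [Units.smul_def, Submodule.coe_pointwise_smul, ← Set.image_smul]
  have h := Submodule.map_span (DistribSMul.toLinearMap F E (u : E)) (M : Set E)
  rw [hM, Submodule.map_top, LinearMap.range_eq_top.mpr (fun x => ⟨(u : E)⁻¹ * x, by simp⟩)] at h
  exact h.symm

/-- `Eˣ` acts on fractional ideals by multiplication. -/
noncomputable instance : MulAction Eˣ R.FracIdeal where
  smul u M := ⟨u • M.1, M.2.1.map _, R.span_units_smul u M.1 M.2.2⟩
  one_smul M := Subtype.ext (one_smul Eˣ M.1)
  mul_smul u v M := Subtype.ext (mul_smul u v M.1)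

/-- The ideal class monoid (as a set): fractional ideals modulo multiplication by `Eˣ`. -/
def IdealClassMonoid : Type _ := MulAction.orbitRel.Quotient Eˣ R.FracIdeal

/-- `Λ \ X_R`: fractional ideals modulo multiplication by powers of `ϖ`. -/
def LatticeQuotient (ϖ : Eˣ) : Type _ :=
  MulAction.orbitRel.Quotient (Subgroup.zpowers ϖ) R.FracIdeal

end LocalOrder

/-- The degree `[κ_B : κ_A]` of the extension of residue fields given by a local homomorphism. -/
noncomputable def residueDegree {A B : Type*} [CommRing A] [IsLocalRing A] [CommRing B]
    [IsLocalRing B] (f : A →+* B) [IsLocalHom f] : ℕ :=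
  letI := (IsLocalRing.ResidueField.map f).toAlgebra
  Module.finrank (IsLocalRing.ResidueField A) (IsLocalRing.ResidueField B)

/-- A subring `S` of `E` regarded as an `A`-submodule, where `A` maps into `S`. -/
def subringSubmodule {A : Type*} [CommRing A] [Algebra A E] (S : Subring E)
    (h : ∀ a : A, algebraMap A E a ∈ S) : Submodule A E where
  carrier := S
  zero_mem' := S.zero_mem
  add_mem' := S.add_mem
  smul_mem' a x hx := by
    rw [Algebra.smul_def]
    exact S.mul_mem (h a) hx

/-- The Serre invariant `S_A(R)`: the length of `𝒪[E] / R` as an `A`-module, for `A` mapping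
into `R`. -/
noncomputable def serreInvariant (A : Type*) [CommRing A] [Algebra A E] (R : LocalOrder F E)
    (h : ∀ a : A, algebraMap A E a ∈ R.toSubalgebra) : ℕ∞ :=
  Module.length A
    (subringSubmodule (A := A) 𝒪[E] (fun a => R.le_integers _ (h a)) ⧸
      (subringSubmodule R.toSubalgebra.toSubring h).submoduleOf
        (subringSubmodule (A := A) 𝒪[E] (fun a => R.le_integers _ (h a))))

/-- The ring of integers of an intermediate field `K`, as a subring of `E`. -/
noncomputable def integersOf (K : IntermediateField F E) : Subring E := K.toSubfield.toSubring ⊓ 𝒪[E]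

/-- The image in the residue field of `𝒪[E]` of a subring of `E` (intersected with `𝒪[E]`).
If `S` is an order, or the ring of integers of an intermediate field, this is the residue
field of `S`. -/
noncomputable def residueImage (S : Subring E) : Subring 𝓀[E] :=
  (S.comap (𝒪[E].subtype)).map (IsLocalRing.residue 𝒪[E])

/-- `K / F` has ramification index one (residue fields being finite, this is the same as being
unramified): every element of `K` has the valuation of an element of `F`. -/
def IsUnramifiedSubfield (K : IntermediateField F E) : Prop :=
  ∀ x ∈ K, ∃ a : F, valuation E x = valuation E (algebraMap F E a)

/-- `K` is the unramified extension of `F` in `E` whose residue field is that of `R`. -/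
def IsCoefficientField (R : LocalOrder F E) (K : IntermediateField F E) : Prop :=
  IsUnramifiedSubfield K ∧
    residueImage (integersOf K) = residueImage R.toSubalgebra.toSubring

end

end BassOrder

/-! Write 𝒪 for `𝒪[E]`, 𝔪 for its maximal ideal, Q for the cardinality of κ_R and d for [κ_E : κ_R].
Everything follows from one fact: the R-modules between R and 𝒪 form a finite chain.

For some N, the N-th power of a uniformizer carries 𝒪 onto an ideal of R, so the Bass property makes
𝒪 an R-module on two generators. Let t be an element of the maximal ideal of R that generates that
ideal over 𝒪. Then 𝒪/t𝒪 has dimension at most 2 over κ_R, and 1 spans a line in it, so 𝒪/(R + t𝒪) is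
zero or simple (`exists_isLevelParameter`). Hence the modules between R and 𝒪 are exactly the rings
R_j = R + t^j 𝒪 for 0 ≤ j ≤ n, where n = `levelIndex` is least with t^n 𝒪 ⊆ R (`exists_eq_level`). A
fractional ideal divided by an element of largest valuation contains 1 and lies in 𝒪, so it is a
multiple of some R_j (`exists_eq_units_smul_level`). Proportional rings are equal, so j is unique
and there are n + 1 classes.

The stabilizer of R_j in E^× is R_j^×, so modulo powers of the uniformizer the multiples of R_j
number [𝒪^× : R_j^×]. This index follows from [𝒪 : R_j] = Q^j by counting units in finite local
rings: for j ≥ 1 it is Q^j + (d - 1) Q^(j-1). If n ≥ 1 and t𝒪 = 𝔪^e, two counts of 𝒪/t𝒪 give d e =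
2. Hence d is 1 or 2, and d f(R) = 2n.

The coefficient field K is F(θ), with θ obtained by Hensel's lemma from a generator of κ_R over κ.
Its integers lie in R, and K is unique, because raising to a high power of the cardinality of κ_E
keeps residues but turns congruences modulo 𝔪 into arbitrarily fine ones
(`IsUnramifiedSubfield.integersOf_le`). The module 𝒪/R has n composition factors κ_R, so its length
is n over 𝒪_K and n d_R over 𝔬. -/

namespace BassOrder

/-! ### Counting in finite local rings. -/

section FiniteLocalRings

open IsLocalRing

/-- The nonunits form the maximal ideal, whose cosets number |κ|; multiplying out avoids division.
-/
theorem card_units_mul_card_residueField (A : Type*) [CommRing A] [IsLocalRing A] [Finite A] :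
    Nat.card Aˣ * Nat.card (ResidueField A) = Nat.card A * (Nat.card (ResidueField A) - 1) := by
  have h1 : Nat.card A = Nat.card (ResidueField A) * Nat.card (maximalIdeal A) :=
    AddSubgroup.card_eq_card_quotient_mul_card_addSubgroup (maximalIdeal A).toAddSubgroup
  have h2 : Nat.card A = Nat.card Aˣ + Nat.card (maximalIdeal A) := by
    have e : Aˣ ≃ {x : A // IsUnit x} := unitsEquivProdSubtype A |>.trans
      ⟨fun x => ⟨x.1.1, ⟨⟨x.1.1, x.1.2, x.2.1, x.2.2⟩, rfl⟩⟩,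
       fun x => ⟨(x.2.unit, ↑x.2.unit⁻¹), by simp, by simp⟩,
       fun x => by
        apply Subtype.ext
        apply Prod.ext
        · rfl
        · exact (left_inv_eq_right_inv (x.2.2 : x.1.2 * x.1.1 = 1) (by
            exact IsUnit.mul_val_inv _)).symm,
       fun x => rfl⟩
    rw [Nat.card_congr e, ← Nat.card_sum]
    classical
    exact Nat.card_congr ((Equiv.sumCompl (fun x : A => IsUnit x)).symm.trans
      (Equiv.sumCongr (Equiv.refl _) (Equiv.subtypeEquivRight fun x => by simp)))
  have : Finite (ResidueField A) := Finite.of_surjective _ (residue_surjective (R := A))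
  obtain ⟨k, hk⟩ : ∃ k, Nat.card (ResidueField A) = k + 1 :=
    Nat.exists_eq_succ_of_ne_zero Nat.card_pos.ne'
  rw [hk] at h1 ⊢
  have h3 : Nat.card Aˣ = k * Nat.card (maximalIdeal A) := by
    rw [h1, add_mul, one_mul] at h2
    omega
  rw [h3, h1]
  simp only [Nat.add_sub_cancel]
  ring

theorem card_residueField_eq_of_surjective {A B : Type*} [CommRing A] [IsLocalRing A] [CommRing B]
    [IsLocalRing B] (f : A →+* B) [IsLocalHom f] (hf : Function.Surjective f) :
    Nat.card (ResidueField A) = Nat.card (ResidueField B) :=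
  Nat.card_congr (Equiv.ofBijective (ResidueField.map f) ⟨(ResidueField.map f).injective, by
    intro y
    obtain ⟨b, rfl⟩ := residue_surjective y
    obtain ⟨a, rfl⟩ := hf b
    exact ⟨residue A a, rfl⟩⟩)

/-- Quotient of the unit counts of A and B, cleared of denominators. -/
theorem index_units_range_subtype {A : Type*} [CommRing A] [IsLocalRing A] [Finite A]
    (B : Subring A) [IsLocalRing B] :
    (Units.map (B.subtype : B →* A)).range.index * (Nat.card (ResidueField B) - 1) *
        Nat.card (ResidueField A) =
      B.toAddSubgroup.index * (Nat.card (ResidueField A) - 1) * Nat.card (ResidueField B) := by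
  have h1 := card_units_mul_card_residueField A
  have h2 := card_units_mul_card_residueField B
  have h3 := (Units.map (B.subtype : B →* A)).range.index_mul_card
  have h4 : B.toAddSubgroup.index * Nat.card B = Nat.card A := B.toAddSubgroup.index_mul_card
  have h5 : Nat.card (Units.map (B.subtype : B →* A)).range = Nat.card Bˣ :=
    (Nat.card_congr (MonoidHom.ofInjective
      (Units.map_injective (f := (B.subtype : B →* A)) Subtype.val_injective)).toEquiv).symm
  rw [h5] at h3
  rw [← h3, ← h4] at h1
  have hB : 0 < Nat.card B := Nat.card_pos
  refine Nat.eq_of_mul_eq_mul_left hB ?_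
  calc _ = (Units.map (B.subtype : B →* A)).range.index *
        (Nat.card B * (Nat.card (ResidueField B) - 1)) * Nat.card (ResidueField A) := by ring
    _ = ((Units.map (B.subtype : B →* A)).range.index * Nat.card Bˣ *
        Nat.card (ResidueField A)) * Nat.card (ResidueField B) := by rw [← h2]; ring
    _ = _ := by rw [h1]; ring

/-- Every composition factor over a local ring is the residue field. -/
theorem card_eq_pow_of_length_eq {R : Type*} [CommRing R] [IsLocalRing R]
    {M : Type*} [AddCommGroup M] [Module R M] {k : ℕ} (h : Module.length R M = k) :
    Nat.card M = Nat.card (ResidueField R) ^ k := by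
  have hfin : IsFiniteLength R M := Module.length_ne_top_iff.mp (by simp [h])
  induction hfin generalizing k with
  | of_subsingleton =>
    rw [Module.length_eq_zero] at h
    have : k = 0 := by exact_mod_cast h.symm
    simp [this]
  | @of_simple_quotient M _ _ N hs hN ih =>
    have h1 := Module.length_eq_add_of_exact N.subtype N.mkQ N.subtype_injective
      N.mkQ_surjective (LinearMap.exact_subtype_mkQ N)
    rw [h, Module.length_eq_one R (M ⧸ N)] at h1
    have h2 : Module.length R N ≠ ⊤ := Module.length_ne_top_iff.mpr hN
    obtain ⟨l, hl⟩ := ENat.ne_top_iff_exists.mp h2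
    rw [← hl] at h1
    have hkl : k = l + 1 := by exact_mod_cast h1
    obtain ⟨m, hm, ⟨e⟩⟩ := isSimpleModule_iff_quot_maximal.mp hs
    obtain rfl := eq_maximalIdeal hm
    have h3 : Nat.card M = Nat.card (M ⧸ N) * Nat.card N :=
      AddSubgroup.card_eq_card_quotient_mul_card_addSubgroup N.toAddSubgroup
    rw [h3, ih hl.symm, hkl, pow_succ', Nat.card_congr e.toEquiv]
    rfl

/-- Each q-th power gains one factor of I: in a^q - b^q = (a - b) · Σ the sum is congruent to q
b^(q-1) modulo I, hence lies in I. -/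
theorem pow_sub_pow_mem_pow {A : Type*} [CommRing A] (I : Ideal A) (q : ℕ) (hq : (q : A) ∈ I)
    {x y : A} (h : x - y ∈ I) (n : ℕ) : x ^ q ^ n - y ^ q ^ n ∈ I ^ (n + 1) := by
  have key : ∀ (k : ℕ) (a b : A), a - b ∈ I ^ (k + 1) → a ^ q - b ^ q ∈ I ^ (k + 2) := by
    intro k a b hab
    rw [← Commute.geom_sum₂_mul (Commute.all a b), pow_succ' I (k + 1)]
    refine Ideal.mul_mem_mul ?_ hab
    have hab' : Ideal.Quotient.mk I a = Ideal.Quotient.mk I b :=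
      Ideal.Quotient.eq.mpr (Ideal.pow_le_self (Nat.succ_ne_zero k) hab)
    rw [← Ideal.Quotient.eq_zero_iff_mem] at hq ⊢
    rw [RingHom.map_geom_sum₂, hab', geom_sum₂_self, ← map_natCast (Ideal.Quotient.mk I),
      hq, zero_mul]
  induction n with
  | zero => simpa using h
  | succ n ih => rw [pow_succ q, pow_mul, pow_mul]; exact key n _ _ ih

end FiniteLocalRings

end BassOrder

/-! ### Valuations, the conductor, and the level parameter of a Bass order. -/

namespace BassOrder

section IntegersOfLocalField

variable {E : Type*} [Field E] [ValuativeRel E]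

theorem mem_maximalIdeal_iff_valuation_lt_one (x : 𝒪[E]) : x ∈ 𝓂[E] ↔ valuation E x < 1 := by
  rw [IsLocalRing.mem_maximalIdeal, mem_nonunits_iff,
    (Valuation.integer.integers (valuation E)).isUnit_iff_valuation_eq_one]
  exact ⟨fun h => lt_of_le_of_ne x.2 h, fun h => h.ne⟩

theorem exists_mul_of_valuation_le {x t : E} (ht : t ≠ 0) (h : valuation E x ≤ valuation E t) :
    ∃ y ∈ 𝒪[E], x = t * y := by
  refine ⟨x / t, ?_, by field_simp⟩
  rw [Valuation.mem_integer_iff, map_div₀]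
  exact div_le_one_of_le₀ h zero_le

theorem valuation_mul_le {x y : E} (hy : y ∈ 𝒪[E]) : valuation E (x * y) ≤ valuation E x := by
  rw [map_mul]
  exact mul_le_of_le_one_right' hy

variable [TopologicalSpace E] [IsNonarchimedeanLocalField E]

theorem exists_valuation_eq_pow {ϖ : E} (hm : ϖ ∈ 𝒪[E]) (hϖ : 𝓂[E] = Ideal.span {⟨ϖ, hm⟩})
    {x : E} (hx : x ∈ 𝒪[E]) (hx0 : x ≠ 0) : ∃ k : ℕ, valuation E x = valuation E ϖ ^ k := by
  have hirr := (IsDiscreteValuationRing.irreducible_iff_uniformizer (⟨ϖ, hm⟩ : 𝒪[E])).mpr hϖ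
  obtain ⟨k, u, hu⟩ := IsDiscreteValuationRing.eq_unit_mul_pow_irreducible
    (x := (⟨x, hx⟩ : 𝒪[E])) (fun h => hx0 (congrArg Subtype.val h)) hirr
  refine ⟨k, ?_⟩
  have h1 : x = (u : 𝒪[E]) * ϖ ^ k := congrArg Subtype.val hu
  have h2 := (Valuation.integer.integers (valuation E)).isUnit_iff_valuation_eq_one.mp u.isUnit
  change valuation E ((u : 𝒪[E]) : E) = 1 at h2
  rw [h1, map_mul, map_pow, h2, one_mul]

theorem exists_valuation_eq_zpow {ϖ : E} (hm : ϖ ∈ 𝒪[E]) (hϖ : 𝓂[E] = Ideal.span {⟨ϖ, hm⟩})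
    {x : E} (hx0 : x ≠ 0) : ∃ k : ℤ, valuation E x = valuation E ϖ ^ k := by
  rcases le_total (valuation E x) 1 with h | h
  · obtain ⟨k, hk⟩ := exists_valuation_eq_pow hm hϖ (x := x) h hx0
    exact ⟨k, by simpa using hk⟩
  · obtain ⟨k, hk⟩ := exists_valuation_eq_pow hm hϖ (x := x⁻¹)
      (by rw [Valuation.mem_integer_iff, map_inv₀]; exact inv_le_one_of_one_le₀ h) (inv_ne_zero hx0)
    refine ⟨-k, ?_⟩
    rw [map_inv₀] at hk
    rw [zpow_neg, zpow_natCast, ← hk, inv_inv]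

variable (E) in
theorem exists_uniformizer : ∃ ϖ : E, ϖ ≠ 0 ∧ valuation E ϖ < 1 ∧
    ∃ h : ϖ ∈ 𝒪[E], 𝓂[E] = Ideal.span {⟨ϖ, h⟩} := by
  obtain ⟨p, hp⟩ := IsDiscreteValuationRing.exists_irreducible 𝒪[E]
  have hp' := (IsDiscreteValuationRing.irreducible_iff_uniformizer p).mp hp
  refine ⟨p, fun h => hp.ne_zero (Subtype.ext h), ?_, p.2, hp'⟩
  rw [← mem_maximalIdeal_iff_valuation_lt_one, hp']
  exact Ideal.mem_span_singleton_self p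

end IntegersOfLocalField

section

set_option linter.unusedSectionVars false

variable {F E : Type*} [Field F] [ValuativeRel F] [TopologicalSpace F]
  [IsNonarchimedeanLocalField F] [Field E] [ValuativeRel E] [TopologicalSpace E]
  [IsNonarchimedeanLocalField E] [Algebra F E] [ValuativeExtension F E]

theorem valuation_algebraMap_lt_iff (a b : F) :
    valuation E (algebraMap F E a) < valuation E (algebraMap F E b) ↔
      valuation F a < valuation F b := by
  rw [← ValuativeExtension.mapValueGroupWithZero_valuation,
    ← ValuativeExtension.mapValueGroupWithZero_valuation]
  exact ValuativeExtension.mapValueGroupWithZero_strictMono.lt_iff_lt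

theorem valuation_algebraMap_lt_one_iff (a : F) :
    valuation E (algebraMap F E a) < 1 ↔ valuation F a < 1 := by
  simpa using valuation_algebraMap_lt_iff (E := E) a 1

namespace LocalOrder

variable (R : LocalOrder F E)

theorem algebraMap_mem {a : F} (ha : a ∈ 𝒪[F]) : algebraMap F E a ∈ R.toSubalgebra :=
  R.toSubalgebra.algebraMap_mem (⟨a, ha⟩ : 𝒪[F])

theorem mem_conductor_iff (a : 𝒪[E]) :
    a ∈ R.conductor ↔ ∀ b ∈ 𝒪[E], (a : E) * b ∈ R.toSubalgebra :=
  ⟨fun h b hb => h ⟨b, hb⟩, fun h b => h b b.2⟩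

variable [FiniteDimensional F E]

theorem mem_of_valuation_eq_one {x : E} (hx : x ∈ R.toSubalgebra) (h : valuation E x = 1) :
    x⁻¹ ∈ R.toSubalgebra := by
  have hu : IsUnit (R.toIntegers ⟨x, hx⟩) :=
    (Valuation.integer.integers (valuation E)).isUnit_iff_valuation_eq_one.mpr h
  obtain ⟨y, hy⟩ := (isUnit_of_map_unit R.toIntegers ⟨x, hx⟩ hu).exists_right_inv
  have : x * y = 1 := congrArg Subtype.val hy
  rw [← eq_inv_of_mul_eq_one_right this]
  exact y.2

theorem mem_maximalIdeal_iff (x : R) :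
    x ∈ IsLocalRing.maximalIdeal R ↔ valuation E (x : E) < 1 := by
  have := mem_maximalIdeal_iff_valuation_lt_one (R.toIntegers x)
  rw [← show ((R.toIntegers x : 𝒪[E]) : E) = x from rfl, ← this, IsLocalRing.mem_maximalIdeal,
    IsLocalRing.mem_maximalIdeal, mem_nonunits_iff, mem_nonunits_iff, isUnit_map_iff]

/-- R is open, so it contains a ball around 0. -/
theorem exists_pow_mul_mem {t : E} (ht : valuation E t < 1) :
    ∃ N : ℕ, ∀ y ∈ 𝒪[E], t ^ N * y ∈ R.toSubalgebra := by
  have h := R.isOpen.mem_nhds R.toSubalgebra.zero_mem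
  obtain ⟨γ, hγ, hs⟩ := (IsValuativeTopology.hasBasis_nhds_zero' E).mem_iff.mp h
  obtain ⟨N, hN⟩ := exists_pow_lt₀ ht (Units.mk0 γ hγ)
  refine ⟨N, fun y hy => hs ?_⟩
  refine (valuation_mul_le hy).trans_lt ?_
  simpa using hN

theorem conductor_eq_pow : R.conductor = 𝓂[E] ^ R.conductorExponent := by
  obtain ⟨p, hp⟩ := IsDiscreteValuationRing.exists_irreducible 𝒪[E]
  have hp' := (IsDiscreteValuationRing.irreducible_iff_uniformizer p).mp hp
  have hlt : valuation E (p : E) < 1 := by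
    rw [← mem_maximalIdeal_iff_valuation_lt_one, hp']
    exact Ideal.mem_span_singleton_self p
  obtain ⟨N, hN⟩ := R.exists_pow_mul_mem hlt
  -- A zero conductor would make the infimum defining `conductorExponent` that of the empty set,
  -- with default value 0.
  have hne : R.conductor ≠ ⊥ := by
    intro h
    have : p ^ N ∈ R.conductor := (R.mem_conductor_iff _).mpr fun b hb => by simpa using hN b hb
    rw [h, Ideal.mem_bot] at this
    exact pow_ne_zero N hp.ne_zero this
  obtain ⟨m, hm⟩ := IsDiscreteValuationRing.ideal_eq_span_pow_irreducible hne hp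
  rw [← Ideal.span_singleton_pow, ← hp'] at hm
  have : R.conductorExponent = m := by
    have hset : {k : ℕ | 𝓂[E] ^ k ≤ R.conductor} = Set.Ici m := by
      ext k
      rw [hm]
      refine ⟨fun h => ?_, fun h => Ideal.pow_le_pow_right h⟩
      by_contra hlt
      have h2 : 𝓂[E] ^ k ≤ 𝓂[E] ^ (k + 1) :=
        le_trans h (Ideal.pow_le_pow_right (by simpa using hlt))
      refine (Ideal.pow_succ_lt_pow (P := 𝓂[E]) ?_ k).not_ge h2
      rw [hp']
      simpa using hp.ne_zero
    rw [conductorExponent, hset, csInf_Ici]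
  rw [this, hm]

/-- `t` generates the ideal of `𝒪[E]` generated by the maximal ideal of `R`, and the quotient
of `𝒪[E]` by `R + t 𝒪[E]` is zero or simple as an `R`-module. -/
structure IsLevelParameter (t : E) : Prop where
  mem : t ∈ R.toSubalgebra
  ne_zero : t ≠ 0
  lt_one : valuation E t < 1
  dvd : ∀ x ∈ R.toSubalgebra, valuation E x < 1 → ∃ y ∈ 𝒪[E], x = t * y
  alt : ∀ u ∈ 𝒪[E], (∃ r ∈ R.toSubalgebra, ∃ y ∈ 𝒪[E], u = r + t * y) ∨
    ∀ w ∈ 𝒪[E], ∃ r ∈ R.toSubalgebra, ∃ s ∈ R.toSubalgebra, ∃ y ∈ 𝒪[E], w = r + s * u + t * y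

variable {R}

/-- The ideal p^N 𝒪 of R is isomorphic to 𝒪 as an R-module, so its two generators can be divided by
p^N. -/
theorem IsBass.exists_generators (hR : R.IsBass) : ∃ x ∈ 𝒪[E], ∃ y ∈ 𝒪[E], ∀ w ∈ 𝒪[E],
    ∃ r ∈ R.toSubalgebra, ∃ s ∈ R.toSubalgebra, w = r * x + s * y := by
  obtain ⟨p, hp0, hp1, -⟩ := exists_uniformizer E
  obtain ⟨N, hN⟩ := R.exists_pow_mul_mem hp1
  have hpN : p ^ N ≠ 0 := pow_ne_zero _ hp0
  let I : Ideal R :=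
    { carrier := {z | ∃ w ∈ 𝒪[E], (z : E) = p ^ N * w}
      zero_mem' := ⟨0, zero_mem _, by simp⟩
      add_mem' := by
        rintro a b ⟨w, hw, ha⟩ ⟨w', hw', hb⟩
        exact ⟨w + w', add_mem hw hw', by push_cast; rw [ha, hb]; ring⟩
      smul_mem' := by
        rintro c a ⟨w, hw, ha⟩
        exact ⟨c * w, mul_mem (R.le_integers _ c.2) hw, by
          rw [smul_eq_mul]; push_cast; rw [ha]; ring⟩ }
  obtain ⟨a, b, hab⟩ := hR I
  have hmem : ∀ w, (hw : w ∈ 𝒪[E]) → ⟨p ^ N * w, hN w hw⟩ ∈ I := fun w hw => ⟨w, hw, rfl⟩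
  obtain ⟨x, hx, hax⟩ : a ∈ I := hab ▸ Ideal.subset_span (by simp)
  obtain ⟨y, hy, hby⟩ : b ∈ I := hab ▸ Ideal.subset_span (by simp)
  refine ⟨x, hx, y, hy, fun w hw => ?_⟩
  have h := hmem w hw
  rw [hab, Ideal.mem_span_pair] at h
  obtain ⟨r, s, hrs⟩ := h
  refine ⟨r, r.2, s, s.2, mul_left_cancel₀ hpN ?_⟩
  have := congrArg Subtype.val hrs
  push_cast at this
  rw [← this, hax, hby]
  ring

/-- Take for t a nonzero nonunit of R of least exponent. The alternative expresses that 𝒪/t𝒪 is at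
most a plane over κ_R containing the line of 1: a further element u either lies on that line or
completes a basis. -/
theorem IsBass.exists_isLevelParameter (hR : R.IsBass) : ∃ t, R.IsLevelParameter t := by
  classical
  obtain ⟨ϖ, hϖ0, hϖ1, hm, hϖ⟩ := exists_uniformizer E
  obtain ⟨p, hp0, hp1, hpm, -⟩ := exists_uniformizer F
  have hpR := R.algebraMap_mem hpm
  have hp0' : algebraMap F E p ≠ 0 := by simpa using hp0
  -- A uniformizer of F witnesses that some exponent occurs.
  have hex : ∃ k : ℕ, ∃ x ∈ R.toSubalgebra, x ≠ 0 ∧ valuation E x < 1 ∧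
      valuation E x = valuation E ϖ ^ k := by
    obtain ⟨k, hk⟩ := exists_valuation_eq_pow hm hϖ (R.le_integers _ hpR) hp0'
    exact ⟨k, _, hpR, hp0', (valuation_algebraMap_lt_one_iff p).mpr hp1, hk⟩
  obtain ⟨t, htR, ht0, ht1, htk⟩ := Nat.find_spec hex
  have hdvd : ∀ x ∈ R.toSubalgebra, valuation E x < 1 → ∃ y ∈ 𝒪[E], x = t * y := by
    intro x hx hx1
    rcases eq_or_ne x 0 with rfl | hx0
    · exact ⟨0, zero_mem _, by simp⟩
    refine exists_mul_of_valuation_le ht0 ?_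
    obtain ⟨k, hk⟩ := exists_valuation_eq_pow hm hϖ (R.le_integers _ hx) hx0
    rw [hk, htk]
    exact pow_le_pow_right_of_le_one' hϖ1.le (Nat.find_min' hex ⟨x, hx, hx0, hx1, hk⟩)
  refine ⟨t, htR, ht0, ht1, hdvd, fun u hu => ?_⟩
  obtain ⟨x, hx, y, hy, hxy⟩ := hR.exists_generators
  -- In the generators x, y write 1 = a x + b y with a a unit, and u = c x + d y. If the determinant
  -- ad - bc is a nonunit, it is divisible by t and u ≡ c/a modulo t𝒪. If it is a unit, Cramer's
  -- rule expresses x and y through 1 and u, so these generate 𝒪.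
  have main : ∀ x ∈ 𝒪[E], ∀ y ∈ 𝒪[E],
      (∀ w ∈ 𝒪[E], ∃ r ∈ R.toSubalgebra, ∃ s ∈ R.toSubalgebra, w = r * x + s * y) →
      ∀ a ∈ R.toSubalgebra, ∀ b ∈ R.toSubalgebra, 1 = a * x + b * y → valuation E a = 1 →
      (∃ r ∈ R.toSubalgebra, ∃ y ∈ 𝒪[E], u = r + t * y) ∨
      ∀ w ∈ 𝒪[E], ∃ r ∈ R.toSubalgebra, ∃ s ∈ R.toSubalgebra, ∃ y ∈ 𝒪[E],
        w = r + s * u + t * y := by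
    intro x hx y hy hxy a ha b hb hab ha1
    obtain ⟨c, hc, d, hd, hcd⟩ := hxy u hu
    have ha0 : a ≠ 0 := by rintro rfl; simp at ha1
    have haR := R.mem_of_valuation_eq_one ha ha1
    have hdet : a * d - b * c ∈ R.toSubalgebra := sub_mem (mul_mem ha hd) (mul_mem hb hc)
    have hle : valuation E (a * d - b * c) ≤ 1 := R.le_integers _ hdet
    rcases hle.lt_or_eq with hlt | heq
    · left
      obtain ⟨z, hz, hzd⟩ := hdvd _ hdet hlt
      refine ⟨c * a⁻¹, mul_mem hc haR, a⁻¹ * z * y,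
        mul_mem (mul_mem (R.le_integers _ haR) hz) hy, ?_⟩
      have : t * (a⁻¹ * z * y) = a⁻¹ * (a * d - b * c) * y := by rw [hzd]; ring
      rw [this, hcd]
      have h1 : a * x = 1 - b * y := by rw [hab]; ring
      field_simp
      linear_combination c * h1
    · right
      have hdR := R.mem_of_valuation_eq_one hdet heq
      have hd0 : a * d - b * c ≠ 0 := by intro h; simp [h] at heq
      intro w hw
      obtain ⟨r, hr, s, hs, hrs⟩ := hxy w hw
      have hX : x = (a * d - b * c)⁻¹ * (d - b * u) := by
        rw [eq_inv_mul_iff_mul_eq₀ hd0, hcd]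
        linear_combination -d * hab
      have hY : y = (a * d - b * c)⁻¹ * (a * u - c) := by
        rw [eq_inv_mul_iff_mul_eq₀ hd0, hcd]
        linear_combination c * hab
      refine ⟨(a * d - b * c)⁻¹ * (r * d - s * c), mul_mem hdR (sub_mem (mul_mem hr hd)
        (mul_mem hs hc)), (a * d - b * c)⁻¹ * (s * a - r * b), mul_mem hdR (sub_mem (mul_mem hs ha)
        (mul_mem hr hb)), 0, zero_mem _, ?_⟩
      rw [hrs]
      nth_rewrite 1 [hX, hY]
      ring
  obtain ⟨a, ha, b, hb, hab⟩ := hxy 1 (one_mem _)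
  -- Otherwise 1 = a x + b y would lie in 𝔪. The roles of x and y are interchangeable.
  have hv : valuation E a = 1 ∨ valuation E b = 1 := by
    by_contra! h
    have h1 : valuation E (a * x) < 1 :=
      (valuation_mul_le hx).trans_lt (lt_of_le_of_ne (R.le_integers _ ha) h.1)
    have h2 : valuation E (b * y) < 1 :=
      (valuation_mul_le hy).trans_lt (lt_of_le_of_ne (R.le_integers _ hb) h.2)
    have := (valuation E).map_add_lt h1 h2
    rw [← hab, map_one] at this
    exact lt_irrefl _ this
  rcases hv with h | h
  · exact main x hx y hy hxy a ha b hb hab h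
  · refine main y hy x hx (fun w hw => ?_) b hb a ha (by rw [hab]; ring) h
    obtain ⟨r, hr, s, hs, hrs⟩ := hxy w hw
    exact ⟨s, hs, r, hr, by rw [hrs]; ring⟩

end LocalOrder

end

end BassOrder

/-! ### The chain R + t^j 𝒪 and the shape of fractional ideals. -/

namespace BassOrder

section

set_option linter.unusedSectionVars false

variable {F E : Type*} [Field F] [ValuativeRel F] [TopologicalSpace F]
  [IsNonarchimedeanLocalField F] [Field E] [ValuativeRel E] [TopologicalSpace E]
  [IsNonarchimedeanLocalField E] [Algebra F E] [ValuativeExtension F E]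

namespace LocalOrder

variable (R : LocalOrder F E)

/-- The `R`-submodule `R + t ^ j 𝒪[E]` of `E`. -/
def level (t : E) (j : ℕ) : Submodule R E where
  carrier := {x | ∃ r ∈ R.toSubalgebra, ∃ y ∈ 𝒪[E], x = r + t ^ j * y}
  zero_mem' := ⟨0, zero_mem _, 0, zero_mem _, by simp⟩
  add_mem' := by
    rintro _ _ ⟨r, hr, y, hy, rfl⟩ ⟨r', hr', y', hy', rfl⟩
    exact ⟨r + r', add_mem hr hr', y + y', add_mem hy hy', by ring⟩
  smul_mem' := by
    rintro c _ ⟨r, hr, y, hy, rfl⟩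
    refine ⟨c * r, mul_mem c.2 hr, c * y, mul_mem (R.le_integers _ c.2) hy, ?_⟩
    rw [Algebra.smul_def]
    change (c : E) * _ = _
    ring

variable {R}

theorem smul_mem_of_mem {M : Submodule R E} {r x : E} (hr : r ∈ R.toSubalgebra) (hx : x ∈ M) :
    r * x ∈ M :=
  M.smul_mem (⟨r, hr⟩ : R) hx

theorem mem_units_smul_iff {M : Submodule R E} {u : Eˣ} {x : E} :
    x ∈ u • M ↔ (u : E)⁻¹ * x ∈ M := by
  rw [Units.smul_def, ← SetLike.mem_coe, Submodule.coe_pointwise_smul,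
    Set.mem_smul_set_iff_inv_smul_mem₀ u.ne_zero, smul_eq_mul, SetLike.mem_coe]

theorem mem_level_of_mem {x : E} (hx : x ∈ R.toSubalgebra) (t : E) (j : ℕ) : x ∈ R.level t j :=
  ⟨x, hx, 0, zero_mem _, by simp⟩

theorem pow_mul_mem_level {y : E} (hy : y ∈ 𝒪[E]) (t : E) (j : ℕ) : t ^ j * y ∈ R.level t j :=
  ⟨0, zero_mem _, y, hy, by simp⟩

theorem mem_level_zero_iff {t x : E} : x ∈ R.level t 0 ↔ x ∈ 𝒪[E] := by
  constructor
  · rintro ⟨r, hr, y, hy, rfl⟩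
    simpa using add_mem (R.le_integers _ hr) hy
  · intro hx
    simpa using pow_mul_mem_level (R := R) hx t 0

theorem level_antitone {t : E} (ht : t ∈ 𝒪[E]) : Antitone (R.level t) := by
  rintro i j hij _ ⟨r, hr, y, hy, rfl⟩
  refine ⟨r, hr, t ^ (j - i) * y, mul_mem (pow_mem ht _) hy, ?_⟩
  rw [← mul_assoc, ← pow_add, Nat.add_sub_cancel' hij]

theorem level_le_integers {t : E} (ht : t ∈ 𝒪[E]) {j : ℕ} {x : E} (hx : x ∈ R.level t j) :
    x ∈ 𝒪[E] :=
  mem_level_zero_iff.mp (level_antitone ht (Nat.zero_le j) hx)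

theorem level_mul_mem {t : E} (ht : t ∈ 𝒪[E]) {j : ℕ} {x y : E} (hx : x ∈ R.level t j)
    (hy : y ∈ R.level t j) : x * y ∈ R.level t j := by
  have hx' := level_le_integers ht hx
  obtain ⟨r, hr, z, hz, rfl⟩ := hx
  obtain ⟨s, hs, w, hw, rfl⟩ := hy
  refine ⟨r * s, mul_mem hr hs, (r + t ^ j * z) * w + z * s,
    add_mem (mul_mem hx' hw) (mul_mem hz (R.le_integers _ hs)), by ring⟩

/-- Both modules are rings containing 1, so u lies in the target ring and u⁻¹ in the source;
multiplying by these gives both inclusions. -/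
theorem eq_of_units_smul_level_eq {t : E} (ht : t ∈ 𝒪[E]) {i j : ℕ} {u : Eˣ}
    (h : u • R.level t i = R.level t j) : R.level t i = R.level t j := by
  have h1 : ∀ x, x ∈ R.level t i ↔ u * x ∈ R.level t j := by
    intro x
    rw [← h, mem_units_smul_iff, inv_mul_cancel_left₀ u.ne_zero]
  have one_mem : ∀ k, (1 : E) ∈ R.level t k := mem_level_of_mem (one_mem _) t
  obtain ⟨v, hv, huv⟩ : ∃ v ∈ R.level t i, (u : E) * v = 1 :=
    ⟨(u : E)⁻¹, (h1 _).mpr (by simpa using one_mem j), by simp⟩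
  ext a
  constructor <;> intro ha
  · have := (h1 _).mp (level_mul_mem ht ha hv)
    rwa [mul_left_comm, huv, mul_one] at this
  · rw [h1]
    exact level_mul_mem ht (by simpa using (h1 _).mp (one_mem i)) ha

/-- The least exponent `n` with `t ^ n 𝒪[E] ⊆ R`. -/
noncomputable def levelIndex (R : LocalOrder F E) (t : E) : ℕ :=
  sInf {k : ℕ | ∀ y ∈ 𝒪[E], t ^ k * y ∈ R.toSubalgebra}

variable [FiniteDimensional F E]

namespace IsLevelParameter

variable {t : E} (ht : R.IsLevelParameter t)

include ht

theorem mem_integer : t ∈ 𝒪[E] := ht.lt_one.le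

theorem pow_levelIndex_mul_mem {y : E} (hy : y ∈ 𝒪[E]) :
    t ^ R.levelIndex t * y ∈ R.toSubalgebra :=
  Nat.sInf_mem (s := {k : ℕ | ∀ y ∈ 𝒪[E], t ^ k * y ∈ R.toSubalgebra})
    (R.exists_pow_mul_mem ht.lt_one) y hy

theorem pow_mul_mem {k : ℕ} (hk : R.levelIndex t ≤ k) {y : E} (hy : y ∈ 𝒪[E]) :
    t ^ k * y ∈ R.toSubalgebra := by
  rw [← Nat.add_sub_cancel' hk, pow_add, mul_assoc]
  exact ht.pow_levelIndex_mul_mem (mul_mem (pow_mem ht.mem_integer _) hy)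

theorem mem_level_iff_of_le {k : ℕ} (hk : R.levelIndex t ≤ k) {x : E} :
    x ∈ R.level t k ↔ x ∈ R.toSubalgebra := by
  refine ⟨?_, fun hx => mem_level_of_mem hx t k⟩
  rintro ⟨r, hr, y, hy, rfl⟩
  exact add_mem hr (ht.pow_mul_mem hk hy)

/-- The chain cannot stall before it reaches R: an inclusion R_i ⊆ R_(i+1), multiplied by powers of
t, pushes t^i 𝒪 into R + t^(i+N) 𝒪 for every N, and this is R for large N. -/
theorem levelIndex_le_of_level_le {i j : ℕ} (hij : i < j) (h : R.level t i ≤ R.level t j) :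
    R.levelIndex t ≤ i := by
  have key : ∀ N, ∀ y ∈ 𝒪[E], t ^ i * y ∈ R.level t (i + N) := by
    intro N
    induction N with
    | zero => exact fun y hy => pow_mul_mem_level hy t i
    | succ N ih =>
      intro y hy
      obtain ⟨r, hr, z, hz, hrz⟩ := ih y hy
      obtain ⟨s, hs, w, hw, hsw⟩ := level_antitone ht.mem_integer (show i + 1 ≤ j from hij)
        (h (pow_mul_mem_level hz t i))
      refine ⟨r + t ^ N * s, add_mem hr (mul_mem (pow_mem ht.mem _) hs), w, hw, ?_⟩
      have : t ^ (i + N) * z = t ^ N * (t ^ i * z) := by ring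
      rw [hrz, this, hsw]
      ring
  refine Nat.sInf_le fun y hy => ?_
  exact (ht.mem_level_iff_of_le (Nat.le_add_left _ i)).mp (key (R.levelIndex t) y hy)

theorem eq_of_level_eq {i j : ℕ} (hi : i ≤ R.levelIndex t) (hj : j ≤ R.levelIndex t)
    (h : R.level t i = R.level t j) : i = j := by
  rcases lt_trichotomy i j with hij | hij | hij
  · have := ht.levelIndex_le_of_level_le hij h.le
    omega
  · exact hij
  · have := ht.levelIndex_le_of_level_le hij h.ge
    omega

/-- The index is the least j with t^j 𝒪 ⊆ M. Were M not inside R + t^j 𝒪, a smaller power of t would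
already carry 𝒪 into M. -/
theorem exists_eq_level {M : Submodule R E} (h1 : (1 : E) ∈ M) (hM : ∀ x ∈ M, x ∈ 𝒪[E]) :
    ∃ j ≤ R.levelIndex t, M = R.level t j := by
  classical
  have hRM : ∀ r ∈ R.toSubalgebra, r ∈ M := fun r hr => by
    simpa using smul_mem_of_mem hr h1
  have hex : ∃ k, ∀ y ∈ 𝒪[E], t ^ k * y ∈ M :=
    ⟨_, fun y hy => hRM _ (ht.pow_levelIndex_mul_mem hy)⟩
  refine ⟨Nat.find hex, Nat.find_min' hex fun y hy => hRM _ (ht.pow_levelIndex_mul_mem hy),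
    le_antisymm ?_ ?_⟩
  · have key : ∀ k ≤ Nat.find hex, M ≤ R.level t k := by
      intro k
      induction k with
      | zero => exact fun _ x hx => mem_level_zero_iff.mpr (hM x hx)
      | succ k ih =>
        intro hk x hx
        obtain ⟨r, hr, u, hu, rfl⟩ := ih (by omega) hx
        rcases ht.alt u hu with ⟨s, hs, y, hy, rfl⟩ | hspan
        · exact ⟨r + t ^ k * s, add_mem hr (mul_mem (pow_mem ht.mem _) hs), y, hy, by ring⟩
        -- Here 1 and u generate 𝒪 modulo t𝒪, and M contains t^k and t^k u. Hence t^k 𝒪 ⊆ M +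
        -- t^(k+1) 𝒪; iteration gives t^k 𝒪 ⊆ M with k below the minimum.
        · exfalso
          have htu : t ^ k * u ∈ M := by simpa using sub_mem hx (hRM r hr)
          have htk : t ^ k ∈ M := hRM _ (pow_mem ht.mem _)
          have hN : ∀ N, ∀ w ∈ 𝒪[E], ∃ m ∈ M, ∃ y ∈ 𝒪[E], t ^ k * w = m + t ^ (k + N) * y := by
            intro N
            induction N with
            | zero => exact fun w hw => ⟨0, zero_mem _, w, hw, by simp⟩
            | succ N ihN =>
              intro w hw
              obtain ⟨m, hm, y, hy, hmy⟩ := ihN w hw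
              obtain ⟨a, ha, b, hb, z, hz, rfl⟩ := hspan y hy
              refine ⟨m + (t ^ N * a * t ^ k + t ^ N * b * (t ^ k * u)), add_mem hm (add_mem
                (smul_mem_of_mem (mul_mem (pow_mem ht.mem _) ha) htk)
                (smul_mem_of_mem (mul_mem (pow_mem ht.mem _) hb) htu)), z, hz, ?_⟩
              rw [hmy]
              ring
          refine Nat.find_min hex (Nat.lt_of_succ_le hk) fun w hw => ?_
          obtain ⟨m, hm, y, hy, hmy⟩ := hN (R.levelIndex t) w hw
          rw [hmy]
          exact add_mem hm (hRM _ (ht.pow_mul_mem (Nat.le_add_left _ _) hy))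
    exact key _ le_rfl
  · rintro _ ⟨r, hr, y, hy, rfl⟩
    exact add_mem (hRM r hr) (Nat.find_spec hex y hy)

/-- A generator of largest valuation has largest valuation in all of M, since R ⊆ 𝒪. Dividing by it
puts M between R and 𝒪. -/
theorem exists_eq_units_smul_level (M : R.FracIdeal) :
    ∃ u : Eˣ, ∃ j ≤ R.levelIndex t, M.1 = u • R.level t j := by
  obtain ⟨M, ⟨S, hS⟩, hspan⟩ := M
  have hne : ∃ x ∈ S, x ≠ 0 := by
    by_contra! h
    have hbot : M = ⊥ := by
      rw [← hS, Submodule.span_eq_bot]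
      exact h
    rw [hbot] at hspan
    have : (1 : E) ∈ Submodule.span F ((⊥ : Submodule R E) : Set E) := hspan ▸ Submodule.mem_top
    simp at this
  obtain ⟨x, hxS, hmax⟩ := S.exists_max_image (valuation E) ⟨_, hne.choose_spec.1⟩
  have hx0 : x ≠ 0 := by
    rintro rfl
    obtain ⟨y, hy, hy0⟩ := hne
    have := hmax y hy
    rw [map_zero, le_zero_iff, map_eq_zero] at this
    exact hy0 this
  have hle : ∀ y ∈ M, valuation E y ≤ valuation E x := by
    intro y hy
    rw [← hS] at hy
    induction hy using Submodule.span_induction with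
    | mem y hy => exact hmax y hy
    | zero => simp
    | add a b _ _ ha hb => exact (valuation E).map_add_le ha hb
    | smul c a _ ha =>
      rw [Algebra.smul_def, mul_comm]
      exact (valuation_mul_le (R.le_integers _ c.2)).trans ha
  let u : Eˣ := Units.mk0 x hx0
  have hmem : ∀ y, y ∈ u⁻¹ • M ↔ x * y ∈ M := by
    intro y
    rw [mem_units_smul_iff, Units.val_inv_eq_inv_val, inv_inv]
    rfl
  obtain ⟨j, hj, hMj⟩ := ht.exists_eq_level (M := u⁻¹ • M)
    ((hmem 1).mpr (by rw [mul_one, ← hS]; exact Submodule.subset_span hxS)) (by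
      intro y hy
      have := hle _ ((hmem y).mp hy)
      rw [map_mul] at this
      exact (mul_le_iff_le_one_right (zero_lt_iff.mpr (by simpa using hx0))).mp this)
  exact ⟨u, j, hj, by rw [← hMj, smul_inv_smul]⟩

end IsLevelParameter

end LocalOrder

end

end BassOrder

/-! ### The class count, and lengths of the quotients of the chain. -/

namespace BassOrder

/-- The length of a module is the Krull dimension of its submodule lattice, which will be a finite
chain. -/
theorem krullDim_fin_succ (k : ℕ) : Order.krullDim (Fin (k + 1)) = k := by
  refine le_antisymm (iSup_le fun p => ?_) ?_
  · have := p.length_lt_card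
    rw [Fintype.card_fin] at this
    exact_mod_cast Nat.le_of_lt_succ this
  · exact le_iSup (fun p : LTSeries (Fin (k + 1)) => ((p.length : ℕ∞) : WithBot ℕ∞)) ⟨k, id, fun i => i.castSucc_lt_succ⟩

section

set_option linter.unusedSectionVars false

variable {F E : Type*} [Field F] [ValuativeRel F] [TopologicalSpace F]
  [IsNonarchimedeanLocalField F] [Field E] [ValuativeRel E] [TopologicalSpace E]
  [IsNonarchimedeanLocalField E] [Algebra F E] [ValuativeExtension F E] [FiniteDimensional F E]

namespace LocalOrder

variable {R : LocalOrder F E}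

/-- The fractional ideal `R + t ^ j 𝒪[E]` of a Bass order `R`. -/
def IsBass.levelIdeal (hR : R.IsBass) (t : E) (j : ℕ) : R.FracIdeal :=
  ⟨R.level t j, by
    classical
    obtain ⟨x, hx, y, hy, hxy⟩ := hR.exists_generators
    refine ⟨{1, t ^ j * x, t ^ j * y}, le_antisymm ?_ ?_⟩
    · rw [Submodule.span_le]
      intro z hz
      simp only [Finset.coe_insert, Finset.coe_singleton, Set.mem_insert_iff,
        Set.mem_singleton_iff] at hz
      rcases hz with rfl | rfl | rfl
      · exact mem_level_of_mem (one_mem _) t j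
      · exact pow_mul_mem_level hx t j
      · exact pow_mul_mem_level hy t j
    · rintro _ ⟨r, hr, w, hw, rfl⟩
      obtain ⟨a, ha, b, hb, rfl⟩ := hxy w hw
      have hsub : ∀ z ∈ ({1, t ^ j * x, t ^ j * y} : Finset E),
          z ∈ Submodule.span R (({1, t ^ j * x, t ^ j * y} : Finset E) : Set E) :=
        fun z hz => Submodule.subset_span hz
      have : r + t ^ j * (a * x + b * y) = r * 1 + (a * (t ^ j * x) + b * (t ^ j * y)) := by ring
      rw [this]
      exact add_mem (smul_mem_of_mem hr (hsub _ (by simp)))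
        (add_mem (smul_mem_of_mem ha (hsub _ (by simp))) (smul_mem_of_mem hb (hsub _ (by simp)))),
   by
    rw [eq_top_iff, ← R.span_eq_top]
    exact Submodule.span_mono fun x hx => mem_level_of_mem hx t j⟩

/-- Splits both orbit counts into the choice of a level and a coset of the stabilizer of that level.
-/
theorem IsBass.units_smul_levelIdeal_eq_iff (hR : R.IsBass) {t : E} (ht : R.IsLevelParameter t)
    {u v : Eˣ} {i j : ℕ} (hi : i ≤ R.levelIndex t) (hj : j ≤ R.levelIndex t) :
    u • hR.levelIdeal t i = v • hR.levelIdeal t j ↔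
      i = j ∧ (v⁻¹ * u) • hR.levelIdeal t i = hR.levelIdeal t i := by
  constructor
  · intro h
    have h' : (v⁻¹ * u) • hR.levelIdeal t i = hR.levelIdeal t j := by
      rw [mul_smul, h, inv_smul_smul]
    have hij := ht.eq_of_level_eq hi hj
      (eq_of_units_smul_level_eq ht.mem_integer (congrArg Subtype.val h'))
    exact ⟨hij, by rw [h', hij]⟩
  · rintro ⟨rfl, h⟩
    rw [mul_smul, inv_smul_eq_iff] at h
    exact h

theorem IsBass.card_idealClassMonoid (hR : R.IsBass) {t : E} (ht : R.IsLevelParameter t) :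
    ENat.card R.IdealClassMonoid = ((R.levelIndex t + 1 : ℕ) : ℕ∞) := by
  let f : Fin (R.levelIndex t + 1) → R.IdealClassMonoid := fun j =>
    (Quotient.mk'' (hR.levelIdeal t j) : MulAction.orbitRel.Quotient Eˣ R.FracIdeal)
  have hf : Function.Bijective f := by
    constructor
    · intro i j hij
      obtain ⟨u, hu⟩ : hR.levelIdeal t i ∈ MulAction.orbit Eˣ (hR.levelIdeal t j) :=
        Quotient.exact hij
      have hu' : u • hR.levelIdeal t j = (1 : Eˣ) • hR.levelIdeal t i := by
        rw [one_smul]; exact hu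
      rw [hR.units_smul_levelIdeal_eq_iff ht (Nat.le_of_lt_succ j.2) (Nat.le_of_lt_succ i.2)] at hu'
      exact Fin.ext hu'.1.symm
    · intro q
      induction q using Quotient.inductionOn' with | _ M
      obtain ⟨u, j, hj, hM⟩ := ht.exists_eq_units_smul_level M
      refine ⟨⟨j, Nat.lt_succ_of_le hj⟩, ?_⟩
      refine (Quotient.sound' (s₁ := MulAction.orbitRel Eˣ R.FracIdeal) ?_).symm
      exact ⟨u, Subtype.ext hM.symm⟩
  rw [← ENat.card_congr (Equiv.ofBijective f hf)]
  simp

section Length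

variable (A : Type*) [CommRing A] [Algebra A E]

/-- The set `R + t ^ j 𝒪[E]` as a module over a ring `A` that maps into `R`. -/
def levelOver (h : ∀ a : A, algebraMap A E a ∈ R.toSubalgebra) (t : E) (j : ℕ) :
    Submodule A E where
  carrier := R.level t j
  zero_mem' := zero_mem _
  add_mem' := add_mem
  smul_mem' a x hx := by
    rw [Algebra.smul_def]
    exact smul_mem_of_mem (h a) hx

variable {A}

/-- Submodules of R_0/R_k are the R_j with j ≤ k, a chain of k + 1 terms. Surjectivity onto R turns
A-submodules into R-submodules. -/
theorem IsLevelParameter.length_level_quotient {t : E} (ht : R.IsLevelParameter t)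
    (h : ∀ a : A, algebraMap A E a ∈ R.toSubalgebra)
    (hs : ∀ x ∈ R.toSubalgebra, ∃ a : A, algebraMap A E a = x) {k : ℕ}
    (hk : k ≤ R.levelIndex t) :
    Module.length A (levelOver A h t 0 ⧸ (levelOver A h t k).submoduleOf (levelOver A h t 0)) =
      k := by
  have hanti : Antitone (levelOver A h t) := level_antitone (R := R) ht.mem_integer
  have hinj : ∀ {i j}, i ≤ R.levelIndex t → j ≤ R.levelIndex t →
      levelOver A h t i = levelOver A h t j → i = j := fun hi hj hij =>
    ht.eq_of_level_eq hi hj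
      (SetLike.ext' (congrArg (fun M : Submodule A E => (M : Set E)) hij :))
  have hex : ∀ M : Submodule A E, (1 : E) ∈ M → (∀ x ∈ M, x ∈ 𝒪[E]) →
      ∃ j ≤ R.levelIndex t, M = levelOver A h t j := by
    intro M h1 hM
    let M' : Submodule R E :=
      { carrier := M
        zero_mem' := M.zero_mem
        add_mem' := M.add_mem
        smul_mem' := by
          intro c x hx
          obtain ⟨a, ha⟩ := hs c c.2
          change (c : E) * x ∈ M
          rw [← ha, ← Algebra.smul_def]
          exact M.smul_mem a hx }
    obtain ⟨j, hj, hMj⟩ := ht.exists_eq_level (M := M') h1 hM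
    exact ⟨j, hj, SetLike.ext' (congrArg (fun M : Submodule R E => (M : Set E)) hMj :)⟩
  set O := levelOver A h t 0
  set N := (levelOver A h t k).submoduleOf O
  -- The levels decrease in j, so the index is reversed to make φ increasing.
  let φ : Fin (k + 1) → Submodule A (O ⧸ N) := fun j =>
    ((levelOver A h t (k - j)).submoduleOf O).map N.mkQ
  have hcomap : ∀ j, (φ j).comap N.mkQ = (levelOver A h t (k - j)).submoduleOf O := by
    intro j
    rw [Submodule.comap_map_mkQ, sup_eq_right]
    exact Submodule.comap_mono (hanti (Nat.sub_le _ _))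
  have hmap : ∀ j, ((levelOver A h t j).submoduleOf O).map O.subtype = levelOver A h t j := by
    intro j
    rw [Submodule.submoduleOf, Submodule.map_comap_subtype]
    exact inf_eq_right.mpr (hanti (Nat.zero_le j))
  have hmono : StrictMono φ := by
    refine Monotone.strictMono_of_injective (fun i j hij => Submodule.map_mono
      (Submodule.comap_mono (hanti (Nat.sub_le_sub_left hij k)))) fun i j hij => ?_
    have h1 := congrArg (fun M => (M.comap N.mkQ).map O.subtype) hij
    simp only [hcomap, hmap] at h1
    have := hinj (by omega) (by omega) h1
    ext
    omega
  have hsurj : Function.Surjective φ := by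
    intro M
    have hNM : N ≤ M.comap N.mkQ := Submodule.le_comap_mkQ N M
    have h1 : (1 : E) ∈ (M.comap N.mkQ).map O.subtype :=
      ⟨⟨1, mem_level_of_mem (one_mem _) t 0⟩, hNM (mem_level_of_mem (one_mem _) t k), rfl⟩
    obtain ⟨j, hj, hMj⟩ := hex _ h1 (by
      rintro _ ⟨x, -, rfl⟩
      exact mem_level_zero_iff.mp x.2)
    have hkj : levelOver A h t k ≤ levelOver A h t j := by
      rw [← hMj, ← hmap k]
      exact Submodule.map_mono hNM
    have hjk : j ≤ k := by
      by_contra! h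
      have := ht.levelIndex_le_of_level_le h hkj
      omega
    refine ⟨⟨k - j, by omega⟩, ?_⟩
    have h2 : M.comap N.mkQ = (levelOver A h t j).submoduleOf O := by
      rw [← hMj, Submodule.submoduleOf,
        Submodule.comap_map_eq_of_injective O.injective_subtype]
    simp only [φ, Nat.sub_sub_self hjk]
    rw [← h2, Submodule.map_comap_eq_of_surjective N.mkQ_surjective]
  have := Order.krullDim_eq_of_orderIso (hmono.orderIsoOfSurjective φ hsurj)
  rw [← Module.coe_length] at this
  apply WithBot.coe_injective
  rw [← this, krullDim_fin_succ]
  rfl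

theorem IsLevelParameter.card_level_quotient {t : E} (ht : R.IsLevelParameter t) {k : ℕ}
    (hk : k ≤ R.levelIndex t) :
    Nat.card (levelOver R (fun a => a.2) t 0 ⧸
      (levelOver R (fun a => a.2) t k).submoduleOf (levelOver R (fun a => a.2) t 0)) =
      Nat.card (IsLocalRing.ResidueField R) ^ k :=
  card_eq_pow_of_length_eq (ht.length_level_quotient _ (fun x hx => ⟨⟨x, hx⟩, rfl⟩) hk)

/-- Over R the length is `levelIndex`, and each composition factor κ_R contributes its own length
over κ_A. -/
theorem IsLevelParameter.serreInvariant_eq [IsLocalRing A] [Algebra A R]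
    [IsLocalHom (algebraMap A R)] [IsScalarTower A R E] {t : E} (ht : R.IsLevelParameter t)
    (h : ∀ a : A, algebraMap A E a ∈ R.toSubalgebra) :
    serreInvariant A R h = R.levelIndex t *
      Module.length (IsLocalRing.ResidueField A) (IsLocalRing.ResidueField R) := by
  have h1 := ht.length_level_quotient (A := R) (fun a => a.2) (fun x hx => ⟨⟨x, hx⟩, rfl⟩) le_rfl
  rw [← h1, ← IsLocalRing.length_restrictScalars A R]
  let P := levelOver R (fun a => a.2) t 0
  let N := (levelOver R (fun a => a.2) t (R.levelIndex t)).submoduleOf P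
  let O := subringSubmodule (A := A) 𝒪[E] (fun a => R.le_integers _ (h a))
  let i : O →ₗ[A] P :=
    { toFun := fun x => ⟨x, mem_level_zero_iff.mpr x.2⟩
      map_add' := fun _ _ => rfl
      map_smul' := fun _ _ => rfl }
  let g : O →ₗ[A] P ⧸ N := (N.mkQ.restrictScalars A).comp i
  have hg : Function.Surjective g := by
    intro q
    obtain ⟨x, rfl⟩ := N.mkQ_surjective q
    exact ⟨⟨x, mem_level_zero_iff.mp x.2⟩, rfl⟩
  have hker : LinearMap.ker g = (subringSubmodule R.toSubalgebra.toSubring h).submoduleOf O := by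
    ext x
    refine (Submodule.Quotient.mk_eq_zero N).trans ?_
    exact ht.mem_level_iff_of_le le_rfl
  exact ((Submodule.quotEquivOfEq _ _ hker.symm).trans
    (g.quotKerEquivOfSurjective hg)).length_eq

end Length

end LocalOrder

end

end BassOrder

/-! ### Residue degrees and the conductor exponent. -/

namespace BassOrder

open IsLocalRing

theorem natCard_quotient_pow {A : Type*} [CommRing A] [IsDomain A] [IsDiscreteValuationRing A]
    (k : ℕ) : Nat.card (A ⧸ maximalIdeal A ^ k) = Nat.card (ResidueField A) ^ k := by
  rw [← Submodule.cardQuot_apply, cardQuot_pow_of_prime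
    (IsDiscreteValuationRing.not_a_field A), Submodule.cardQuot_apply]
  rfl

theorem index_eq_card_quotient_submoduleOf {A M G : Type*} [CommRing A] [AddCommGroup M]
    [Module A M] [AddCommGroup G] (P N : Submodule A M) (i : G →+ M)
    (hi : ∀ x, x ∈ P ↔ ∃ g, i g = x) (L : AddSubgroup G) (hL : ∀ g, g ∈ L ↔ i g ∈ N) :
    L.index = Nat.card (P ⧸ N.submoduleOf P) := by
  rw [← Submodule.cardQuot_apply, Submodule.cardQuot]
  let j : G →+ P := i.codRestrict P.toAddSubmonoid fun g => (hi _).mpr ⟨g, rfl⟩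
  have hj : Function.Surjective j := fun x =>
    ((hi x).mp x.2).imp fun _ h => Subtype.ext h
  rw [← AddSubgroup.index_comap_of_surjective _ hj]
  congr 1
  ext g
  exact hL g

theorem index_comap_quotient_mk {A : Type*} [CommRing A] (I : Ideal A) (B : Subring (A ⧸ I)) :
    (B.comap (Ideal.Quotient.mk I)).toAddSubgroup.index = B.toAddSubgroup.index :=
  AddSubgroup.index_comap_of_surjective B.toAddSubgroup (f := (Ideal.Quotient.mk I).toAddMonoidHom)
    Ideal.Quotient.mk_surjective

theorem card_residueField_eq_pow_residueDegree {A B : Type*} [CommRing A] [IsLocalRing A]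
    [CommRing B] [IsLocalRing B] (f : A →+* B) [IsLocalHom f] [Finite (ResidueField A)]
    [Finite (ResidueField B)] :
    Nat.card (ResidueField B) = Nat.card (ResidueField A) ^ residueDegree f := by
  let := (ResidueField.map f).toAlgebra
  have : Fintype (ResidueField A) := Fintype.ofFinite _
  have : Fintype (ResidueField B) := Fintype.ofFinite _
  rw [Nat.card_eq_fintype_card, Nat.card_eq_fintype_card]
  exact Module.card_eq_pow_finrank

section

set_option linter.unusedSectionVars false

variable {F E : Type*} [Field F] [ValuativeRel F] [TopologicalSpace F]
  [IsNonarchimedeanLocalField F] [Field E] [ValuativeRel E] [TopologicalSpace E]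
  [IsNonarchimedeanLocalField E] [Algebra F E] [ValuativeExtension F E] [FiniteDimensional F E]

namespace LocalOrder

variable (R : LocalOrder F E)

instance finite_residueField : Finite (ResidueField R) :=
  Finite.of_injective _ (ResidueField.map R.toIntegers).injective

theorem card_residueField_integers :
    Nat.card 𝓀[E] = Nat.card (ResidueField R) ^ residueDegree R.toIntegers :=
  card_residueField_eq_pow_residueDegree _

theorem card_residueField_eq_pow :
    Nat.card (ResidueField R) = Nat.card 𝓀[F] ^ residueDegree (algebraMap 𝒪[F] R) :=
  card_residueField_eq_pow_residueDegree _

theorem residueDegree_eq_one_iff :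
    residueDegree R.toIntegers = 1 ↔ Nat.card (ResidueField R) = Nat.card 𝓀[E] := by
  have h1 : 1 < Nat.card (ResidueField R) := Finite.one_lt_card
  constructor
  · intro h
    rw [R.card_residueField_integers, h, pow_one]
  · intro h
    rw [R.card_residueField_integers] at h
    have h2 : Nat.card (ResidueField R) ^ 1 =
      Nat.card (ResidueField R) ^ residueDegree R.toIntegers := by rwa [pow_one]
    exact (Nat.pow_right_injective h1 h2).symm

variable {R}

theorem exists_sub_lt_one_of_residueDegree_eq_one (h : residueDegree R.toIntegers = 1) {u : E}
    (hu : u ∈ 𝒪[E]) : ∃ r ∈ R.toSubalgebra, valuation E (u - r) < 1 := by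
  have hbij : Function.Bijective (ResidueField.map R.toIntegers) :=
    (Function.Injective.bijective_of_nat_card_le (ResidueField.map R.toIntegers).injective
      (R.residueDegree_eq_one_iff.mp h).ge)
  obtain ⟨c, hc⟩ := hbij.2 (residue 𝒪[E] ⟨u, hu⟩)
  obtain ⟨r, rfl⟩ := residue_surjective c
  refine ⟨r, r.2, ?_⟩
  rw [ResidueField.map_residue, eq_comm, ← sub_eq_zero, ← map_sub, residue_eq_zero_iff,
    mem_maximalIdeal_iff_valuation_lt_one] at hc
  exact hc

variable {t : E}

/-- The reduction of `R` modulo `t ^ j 𝒪[E]`. -/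
noncomputable def toQuotient (R : LocalOrder F E) (I : Ideal 𝒪[E]) : R →+* 𝒪[E] ⧸ I :=
  (Ideal.Quotient.mk I).comp R.toIntegers

theorem mk_mem_range_toQuotient_iff (ht : t ∈ 𝒪[E]) (j : ℕ) (x : 𝒪[E]) :
    Ideal.Quotient.mk (Ideal.span {⟨t, ht⟩ ^ j}) x ∈
      (R.toQuotient (Ideal.span {⟨t, ht⟩ ^ j})).range ↔ (x : E) ∈ R.level t j := by
  constructor
  · rintro ⟨r, hr⟩
    obtain ⟨y, hy⟩ := Ideal.mem_span_singleton'.mp (Ideal.Quotient.eq.mp hr.symm)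
    refine ⟨r, r.2, y, y.2, ?_⟩
    have := congrArg Subtype.val hy
    simp only [Subring.coe_mul, AddSubgroupClass.coe_sub, SubmonoidClass.coe_pow] at this
    change _ = (x : E) - r at this
    linear_combination -this
  · rintro ⟨r, hr, y, hy, hx⟩
    refine ⟨⟨r, hr⟩, (Ideal.Quotient.eq.mpr (Ideal.mem_span_singleton'.mpr ⟨⟨y, hy⟩, ?_⟩)).symm⟩
    ext
    simp only [Subring.coe_mul, AddSubgroupClass.coe_sub, SubmonoidClass.coe_pow]
    change _ = (x : E) - r
    rw [hx]
    ring

namespace IsLevelParameter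

variable (ht : R.IsLevelParameter t)

include ht

/-- The preimage in 𝒪 of the image of R is R_j, and 𝒪/R_j has length j over R. -/
theorem index_range_toQuotient {j : ℕ} (hj : j ≤ R.levelIndex t) :
    (R.toQuotient (Ideal.span {⟨t, ht.mem_integer⟩ ^ j})).range.toAddSubgroup.index =
      Nat.card (ResidueField R) ^ j := by
  rw [← ht.card_level_quotient hj, ← index_comap_quotient_mk]
  exact index_eq_card_quotient_submoduleOf _ _ 𝒪[E].subtype.toAddMonoidHom
    (fun x => ⟨fun hx => ⟨⟨x, mem_level_zero_iff.mp hx⟩, rfl⟩, by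
      rintro ⟨y, rfl⟩
      exact mem_level_zero_iff.mpr y.2⟩) _
    (fun x => mk_mem_range_toQuotient_iff ht.mem_integer j x)

theorem exists_span_eq_pow : ∃ e ≠ 0, Ideal.span {⟨t, ht.mem_integer⟩} = 𝓂[E] ^ e := by
  obtain ⟨p, hp⟩ := IsDiscreteValuationRing.exists_irreducible 𝒪[E]
  have hp' := (IsDiscreteValuationRing.irreducible_iff_uniformizer p).mp hp
  obtain ⟨e, he⟩ := IsDiscreteValuationRing.ideal_eq_span_pow_irreducible
    (s := Ideal.span {⟨t, ht.mem_integer⟩})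
    (Ideal.span_singleton_eq_bot.not.mpr fun h => ht.ne_zero (congrArg Subtype.val h)) hp
  rw [← Ideal.span_singleton_pow, ← hp'] at he
  refine ⟨e, ?_, he⟩
  rintro rfl
  rw [pow_zero, Ideal.one_eq_top, Ideal.eq_top_iff_one] at he
  have h1 : Ideal.span {⟨t, ht.mem_integer⟩} ≤ 𝓂[E] := by
    rw [Ideal.span_singleton_le_iff_mem, mem_maximalIdeal_iff_valuation_lt_one]
    exact ht.lt_one
  have := (mem_maximalIdeal_iff_valuation_lt_one _).mp (h1 he)
  simp at this

theorem card_range_toQuotient_one :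
    Nat.card (R.toQuotient (Ideal.span {⟨t, ht.mem_integer⟩})).range =
      Nat.card (ResidueField R) := by
  have hker : RingHom.ker (R.toQuotient (Ideal.span {⟨t, ht.mem_integer⟩})) =
      maximalIdeal R := by
    ext x
    rw [RingHom.mem_ker, R.mem_maximalIdeal_iff]
    change Ideal.Quotient.mk _ (R.toIntegers x) = 0 ↔ _
    rw [Ideal.Quotient.eq_zero_iff_mem, Ideal.mem_span_singleton']
    constructor
    · rintro ⟨y, hy⟩
      have : (y : E) * t = x := congrArg Subtype.val hy
      rw [← this, mul_comm]
      exact (valuation_mul_le y.2).trans_lt ht.lt_one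
    · intro h
      obtain ⟨y, hy, hxy⟩ := ht.dvd x x.2 h
      exact ⟨⟨y, hy⟩, Subtype.ext (by rw [mul_comm]; exact hxy.symm)⟩
  rw [← Nat.card_congr (RingHom.quotientKerEquivRange _).toEquiv, hker]
  rfl

/-- Two counts of 𝒪/t𝒪: it has Q^(d e) elements as 𝒪/𝔪^e, and Q · Q through the image of R, which is
a copy of κ_R of index Q. -/
theorem mul_residueDegree_eq_two {e : ℕ} (he : Ideal.span {⟨t, ht.mem_integer⟩} = 𝓂[E] ^ e)
    (hn : R.levelIndex t ≠ 0) : residueDegree R.toIntegers * e = 2 := by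
  have h1 := ht.index_range_toQuotient (Nat.one_le_iff_ne_zero.mpr hn)
  rw [pow_one, pow_one] at h1
  have h2 := (R.toQuotient (Ideal.span {⟨t, ht.mem_integer⟩})).range.toAddSubgroup.index_mul_card
  rw [h1] at h2
  have h3 : Nat.card (𝒪[E] ⧸ (Ideal.span {⟨t, ht.mem_integer⟩} : Ideal 𝒪[E])) =
      Nat.card (ResidueField R) ^ (residueDegree R.toIntegers * e) := by
    rw [he, natCard_quotient_pow, pow_mul, card_residueField_integers R]
  have h4 : Nat.card (ResidueField R) ^ 2 = Nat.card (𝒪[E] ⧸ (Ideal.span {⟨t, ht.mem_integer⟩} : Ideal 𝒪[E])) := by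
    rw [← h2, sq]
    congr 1
    exact ht.card_range_toQuotient_one.symm
  rw [h3] at h4
  exact (Nat.pow_right_injective (Finite.one_lt_card (α := ResidueField R)) h4).symm

theorem mem_of_levelIndex_eq_zero (hn : R.levelIndex t = 0) {x : E} (hx : x ∈ 𝒪[E]) :
    x ∈ R.toSubalgebra := by
  simpa [hn] using ht.pow_levelIndex_mul_mem hx

theorem residueDegree_eq_one_of_levelIndex_eq_zero (hn : R.levelIndex t = 0) :
    residueDegree R.toIntegers = 1 := by
  rw [R.residueDegree_eq_one_iff]
  exact card_residueField_eq_of_surjective R.toIntegers fun x =>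
    ⟨⟨x, ht.mem_of_levelIndex_eq_zero hn x.2⟩, rfl⟩

theorem residueDegree_eq_one_or_two :
    residueDegree R.toIntegers = 1 ∨ residueDegree R.toIntegers = 2 := by
  by_cases hn : R.levelIndex t = 0
  · exact Or.inl (ht.residueDegree_eq_one_of_levelIndex_eq_zero hn)
  · obtain ⟨e, -, he⟩ := ht.exists_span_eq_pow
    have := Dvd.intro _ (ht.mul_residueDegree_eq_two he hn)
    exact (Nat.dvd_prime Nat.prime_two).mp this

/-- Minimality of n = `levelIndex` gives e(n - 1) < f ≤ e n for n ≥ 1. For e = 1 this forces f = n;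
for e = 2 the odd value must be excluded. -/
theorem residueDegree_mul_conductorExponent :
    residueDegree R.toIntegers * R.conductorExponent = 2 * R.levelIndex t := by
  by_cases hn : R.levelIndex t = 0
  · have : R.conductorExponent = 0 := by
      refine Nat.sInf_eq_zero.mpr (Or.inl ?_)
      intro x _ b
      exact ht.mem_of_levelIndex_eq_zero hn (mul_mem x.2 b.2)
    rw [hn, this, mul_zero, mul_zero]
  obtain ⟨e, -, he⟩ := ht.exists_span_eq_pow
  have hde := ht.mul_residueDegree_eq_two he hn
  have hc := R.conductor_eq_pow
  set f := R.conductorExponent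
  have hm0 : 𝓂[E] ≠ ⊥ := IsDiscreteValuationRing.not_a_field 𝒪[E]
  have hpow : ∀ {a b : ℕ}, 𝓂[E] ^ a ≤ 𝓂[E] ^ b ↔ b ≤ a := by
    intro a b
    refine ⟨fun h => ?_, Ideal.pow_le_pow_right⟩
    by_contra! hlt
    exact (Ideal.pow_succ_lt_pow hm0 a).not_ge (h.trans (Ideal.pow_le_pow_right hlt))
  have hek : ∀ k, 𝓂[E] ^ (e * k) = Ideal.span {⟨t, ht.mem_integer⟩ ^ k} := by
    intro k
    rw [pow_mul, ← he, Ideal.span_singleton_pow]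
  have hle : f ≤ e * R.levelIndex t := by
    rw [← hpow, ← hc, hek, Ideal.span_singleton_le_iff_mem, mem_conductor_iff]
    exact fun b hb => ht.pow_levelIndex_mul_mem hb
  have hnot : ¬ ∀ y ∈ 𝒪[E], t ^ (R.levelIndex t - 1) * y ∈ R.toSubalgebra := by
    intro h
    have := Nat.sInf_le (s := {k : ℕ | ∀ y ∈ 𝒪[E], t ^ k * y ∈ R.toSubalgebra}) h
    change R.levelIndex t ≤ _ at this
    omega
  have hlt : e * (R.levelIndex t - 1) < f := by
    by_contra! h
    rw [← hpow, ← hc, hek, Ideal.span_singleton_le_iff_mem, mem_conductor_iff] at h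
    exact hnot h
  obtain ⟨n, hn'⟩ := Nat.exists_eq_succ_of_ne_zero hn
  rw [hn', Nat.succ_sub_one] at hlt hnot
  rw [hn'] at hle ⊢
  rcases ht.residueDegree_eq_one_or_two with hd | hd
  · rw [hd] at hde ⊢
    have he2 : e = 2 := by omega
    subst he2
    -- If 𝔪^(2n+1) ⊆ R, then t^n 𝒪 ⊆ R: since d = 1, each y is r + z with r in R and z in 𝔪, and t^n
    -- z lies in 𝔪^(2n+1). This contradicts the minimality of `levelIndex`, which is now n + 1.
    by_contra hne
    have hf : f = 2 * n + 1 := by omega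
    apply hnot
    intro y hy
    obtain ⟨r, hr, hlt1⟩ := exists_sub_lt_one_of_residueDegree_eq_one hd hy
    have hz : y - r ∈ 𝒪[E] := hlt1.le
    have hzm : (⟨y - r, hz⟩ : 𝒪[E]) ∈ 𝓂[E] := (mem_maximalIdeal_iff_valuation_lt_one _).mpr hlt1
    have hmem : (⟨t, ht.mem_integer⟩ ^ n * ⟨y - r, hz⟩ : 𝒪[E]) ∈ R.conductor := by
      rw [hc, hf, pow_succ]
      refine Ideal.mul_mem_mul ?_ hzm
      rw [hek]
      exact Ideal.mem_span_singleton_self _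
    have := (R.mem_conductor_iff _).mp hmem 1 (one_mem _)
    have h3 : t ^ n * (y - r) ∈ R.toSubalgebra := by simpa using this
    have : t ^ n * y = t ^ n * r + t ^ n * (y - r) := by ring
    rw [this]
    exact add_mem (mul_mem (pow_mem ht.mem _) hr) h3
  · rw [hd] at hde ⊢
    have he1 : e = 1 := by omega
    subst he1
    omega

end IsLevelParameter

end LocalOrder

end

end BassOrder

/-! ### Unit indices and the count modulo powers of the uniformizer. -/

namespace BassOrder

open IsLocalRing

/-- The units of `A` whose reduction modulo `I` is a unit of the image of `f`. -/
def unitsOfRange {A R : Type*} [CommRing A] [CommRing R] (I : Ideal A) (f : R →+* A ⧸ I) :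
    Subgroup Aˣ :=
  (Units.map (f.range.subtype : f.range →* A ⧸ I)).range.comap
    (Units.map (Ideal.Quotient.mk I : A →* A ⧸ I))

theorem mem_unitsOfRange_iff {A R : Type*} [CommRing A] [CommRing R] {I : Ideal A}
    {f : R →+* A ⧸ I} {u : Aˣ} : u ∈ unitsOfRange I f ↔
      Ideal.Quotient.mk I u ∈ f.range ∧ Ideal.Quotient.mk I (u⁻¹ : Aˣ) ∈ f.range := by
  constructor
  · rintro ⟨b, hb⟩
    have h1 : ((b : f.range) : A ⧸ I) = Ideal.Quotient.mk I u := congrArg Units.val hb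
    have h2 : ((b⁻¹ : f.rangeˣ) : f.range) = Ideal.Quotient.mk I (u⁻¹ : Aˣ) :=
      congrArg (fun x : (A ⧸ I)ˣ => ((x⁻¹ : (A ⧸ I)ˣ) : A ⧸ I)) hb
    exact ⟨h1 ▸ b.val.2, h2 ▸ (b⁻¹).val.2⟩
  · rintro ⟨h1, h2⟩
    refine ⟨⟨⟨_, h1⟩, ⟨_, h2⟩, ?_, ?_⟩, Units.ext rfl⟩
    · apply Subtype.ext
      change Ideal.Quotient.mk I u * Ideal.Quotient.mk I (u⁻¹ : Aˣ) = 1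
      rw [← map_mul, Units.mul_inv, map_one]
    · apply Subtype.ext
      change Ideal.Quotient.mk I (u⁻¹ : Aˣ) * Ideal.Quotient.mk I u = 1
      rw [← map_mul, Units.inv_mul, map_one]

/-- Units lift along quotients of local rings, so the index may be computed in the finite ring A/I.
Passing to A/I or to the image of f leaves the residue fields unchanged, as I is proper. -/
theorem index_unitsOfRange {A R : Type*} [CommRing A] [IsLocalRing A] [CommRing R] [IsLocalRing R]
    {I : Ideal A} (hI : I ≠ ⊤) [Finite (A ⧸ I)] (f : R →+* A ⧸ I) :
    (unitsOfRange I f).index * (Nat.card (ResidueField R) - 1) * Nat.card (ResidueField A) =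
      f.range.toAddSubgroup.index * (Nat.card (ResidueField A) - 1) *
        Nat.card (ResidueField R) := by
  have := Ideal.Quotient.nontrivial_iff.mpr hI
  have h1 : Function.Surjective (Ideal.Quotient.mk I) := Ideal.Quotient.mk_surjective
  have := IsLocalRing.of_surjective' (Ideal.Quotient.mk I) h1
  have := h1.isLocalHom
  have h2 := f.rangeRestrict_surjective
  have := IsLocalRing.of_surjective' f.rangeRestrict h2
  have := h2.isLocalHom
  rw [card_residueField_eq_of_surjective _ h1, card_residueField_eq_of_surjective _ h2,
    ← index_units_range_subtype]
  congr 2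
  exact Subgroup.index_comap_of_surjective _
    (IsLocalRing.surjective_units_map_of_local_ringHom _ h1 inferInstance)

/-- After cancelling Q - 1, the case d = 2 leaves the factor Q + 1, the case d = 1 leaves none. -/
theorem eq_of_mul_pred_mul_pow_eq {c Q d j : ℕ} (hQ : 1 < Q) (hd : d = 1 ∨ d = 2)
    (h : c * (Q - 1) * Q ^ d = Q ^ (j + 1) * (Q ^ d - 1) * Q) :
    c = Q ^ (j + 1) + (d - 1) * Q ^ j := by
  obtain ⟨q, rfl⟩ : ∃ q, Q = q + 1 := ⟨Q - 1, by omega⟩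
  have hq : 0 < q := by omega
  have hq1 : 0 < q + 1 := by omega
  rcases hd with rfl | rfl
  · refine Nat.eq_of_mul_eq_mul_right (mul_pos hq hq1) ?_
    simp only [pow_one, Nat.add_sub_cancel] at h
    rw [Nat.sub_self, zero_mul, add_zero, ← mul_assoc, h]
    ring
  · refine Nat.eq_of_mul_eq_mul_right (mul_pos hq (pow_pos hq1 2)) ?_
    have h3 : (q + 1) ^ 2 - 1 = q * (q + 2) := by
      rw [Nat.sub_eq_iff_eq_add (Nat.one_le_pow _ _ hq1)]
      ring
    rw [h3, Nat.add_sub_cancel] at h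
    rw [← mul_assoc, h, Nat.add_sub_cancel_left (n := 1) (m := 1)]
    ring

section

set_option linter.unusedSectionVars false

variable {F E : Type*} [Field F] [ValuativeRel F] [TopologicalSpace F]
  [IsNonarchimedeanLocalField F] [Field E] [ValuativeRel E] [TopologicalSpace E]
  [IsNonarchimedeanLocalField E] [Algebra F E] [ValuativeExtension F E] [FiniteDimensional F E]

namespace LocalOrder

variable {R : LocalOrder F E}

/-- The units of `𝒪[E]` that are units of the ring `R + t ^ j 𝒪[E]`. -/
noncomputable def levelUnits (R : LocalOrder F E) {t : E} (ht : t ∈ 𝒪[E]) (j : ℕ) :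
    Subgroup 𝒪[E]ˣ :=
  unitsOfRange _ (R.toQuotient (Ideal.span {⟨t, ht⟩ ^ j}))

theorem mem_levelUnits_iff {t : E} {ht : t ∈ 𝒪[E]} {j : ℕ} {u : 𝒪[E]ˣ} :
    u ∈ R.levelUnits ht j ↔
      ((u : 𝒪[E]) : E) ∈ R.level t j ∧ ((u⁻¹ : 𝒪[E]ˣ) : E) ∈ R.level t j := by
  rw [levelUnits, mem_unitsOfRange_iff, mk_mem_range_toQuotient_iff, mk_mem_range_toQuotient_iff]

theorem index_levelUnits_zero {t : E} (ht : t ∈ 𝒪[E]) : (R.levelUnits ht 0).index = 1 := by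
  rw [Subgroup.index_eq_one, eq_top_iff]
  intro u _
  exact mem_levelUnits_iff.mpr ⟨mem_level_zero_iff.mpr u.val.2, mem_level_zero_iff.mpr (u⁻¹).val.2⟩

namespace IsLevelParameter

variable {t : E} (ht : R.IsLevelParameter t)

include ht

theorem index_levelUnits {j : ℕ} (hj0 : j ≠ 0) (hj : j ≤ R.levelIndex t) :
    (R.levelUnits ht.mem_integer j).index * (Nat.card (ResidueField R) - 1) * Nat.card 𝓀[E] =
      Nat.card (ResidueField R) ^ j * (Nat.card 𝓀[E] - 1) * Nat.card (ResidueField R) := by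
  obtain ⟨e, he0, he⟩ := ht.exists_span_eq_pow
  have hI : Ideal.span {(⟨t, ht.mem_integer⟩ : 𝒪[E]) ^ j} = 𝓂[E] ^ (e * j) := by
    rw [pow_mul, ← he, Ideal.span_singleton_pow]
  have hne : Ideal.span {(⟨t, ht.mem_integer⟩ : 𝒪[E]) ^ j} ≠ ⊤ := by
    rw [hI]
    exact ne_top_of_le_ne_top (maximalIdeal.isMaximal 𝒪[E]).ne_top
      (Ideal.pow_le_self (mul_ne_zero he0 hj0))
  have hfin : Finite (𝒪[E] ⧸ (Ideal.span {(⟨t, ht.mem_integer⟩ : 𝒪[E]) ^ j})) := by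
    apply Nat.finite_of_card_ne_zero
    rw [hI, natCard_quotient_pow]
    exact pow_ne_zero _ Nat.card_pos.ne'
  rw [← ht.index_range_toQuotient hj]
  exact index_unitsOfRange hne _

theorem index_levelUnits_succ {j : ℕ} (hj : j + 1 ≤ R.levelIndex t) :
    (R.levelUnits ht.mem_integer (j + 1)).index =
      Nat.card (ResidueField R) ^ (j + 1) +
        (residueDegree R.toIntegers - 1) * Nat.card (ResidueField R) ^ j := by
  have h := ht.index_levelUnits (Nat.succ_ne_zero j) hj
  rw [R.card_residueField_integers] at h
  exact eq_of_mul_pred_mul_pow_eq Finite.one_lt_card ht.residueDegree_eq_one_or_two h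

theorem sum_index_levelUnits :
    ∑ j ∈ Finset.range (R.levelIndex t + 1), (R.levelUnits ht.mem_integer j).index =
      Nat.card (ResidueField R) ^ R.levelIndex t + residueDegree R.toIntegers *
        ∑ i ∈ Finset.range (R.levelIndex t), Nat.card (ResidueField R) ^ i := by
  have hd : residueDegree R.toIntegers = (residueDegree R.toIntegers - 1) + 1 := by
    rcases ht.residueDegree_eq_one_or_two with h | h <;> rw [h]
  have h1 : ∑ i ∈ Finset.range (R.levelIndex t),
      (R.levelUnits ht.mem_integer (i + 1)).index = ∑ i ∈ Finset.range (R.levelIndex t),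
        (Nat.card (ResidueField R) ^ (i + 1) +
          (residueDegree R.toIntegers - 1) * Nat.card (ResidueField R) ^ i) :=
    Finset.sum_congr rfl fun i hi => ht.index_levelUnits_succ (Finset.mem_range.mp hi)
  rw [Finset.sum_range_succ', index_levelUnits_zero, h1, Finset.sum_add_distrib, ← Finset.mul_sum,
    hd, add_mul, one_mul, Nat.add_sub_cancel]
  -- The index 1 at level 0 completes the sum of Q^(i+1) to Q^n plus the geometric sum.
  have h2 := Finset.sum_range_succ' (fun i => Nat.card (ResidueField R) ^ i) (R.levelIndex t)
  rw [Finset.sum_range_succ, pow_zero] at h2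
  omega

end IsLevelParameter

/-- The stabilizer of a ring under multiplication is its unit group. -/
theorem units_smul_level_eq_iff {t : E} (ht : t ∈ 𝒪[E]) {j : ℕ} (u : Eˣ) :
    u • R.level t j = R.level t j ↔
      (u : E) ∈ R.level t j ∧ ((u⁻¹ : Eˣ) : E) ∈ R.level t j := by
  have one_mem : (1 : E) ∈ R.level t j := mem_level_of_mem (one_mem _) t j
  constructor
  · intro h
    have h1 := one_mem
    have h2 := Submodule.smul_mem_pointwise_smul (1 : E) (u : E) _ one_mem
    rw [← Units.smul_def, h] at h2
    rw [← h, mem_units_smul_iff] at h1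
    simpa using And.intro h2 h1
  · rintro ⟨h1, h2⟩
    ext x
    rw [mem_units_smul_iff, ← Units.val_inv_eq_inv_val]
    refine ⟨fun h => ?_, fun h => level_mul_mem ht h2 h⟩
    simpa using level_mul_mem ht h1 h

/-- A unit of `𝒪[E]` as a unit of `E`. -/
noncomputable def unitsMap : 𝒪[E]ˣ →* Eˣ := Units.map (𝒪[E].subtype : 𝒪[E] →* E)

theorem valuation_unitsMap (u : 𝒪[E]ˣ) : valuation E (unitsMap u : E) = 1 :=
  (Valuation.integer.integers (valuation E)).isUnit_iff_valuation_eq_one.mp u.isUnit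

theorem exists_unitsMap_eq {u : Eˣ} (hu : valuation E (u : E) = 1) : ∃ v, unitsMap v = u := by
  have hinv : valuation E ((u⁻¹ : Eˣ) : E) = 1 := by
    rw [Units.val_inv_eq_inv_val, map_inv₀, hu, inv_one]
  refine ⟨⟨⟨u, hu.le⟩, ⟨(u⁻¹ : Eˣ), hinv.le⟩, ?_, ?_⟩, Units.ext rfl⟩ <;>
  · apply Subtype.ext
    simp

/-- The fractional ideals of level j form E^×/R_j^×. Since E^× is the product of 𝒪^× and the powers
of the uniformizer, the quotient is 𝒪^×/R_j^×. -/
theorem IsBass.card_latticeQuotient (hR : R.IsBass) {t : E} (ht : R.IsLevelParameter t)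
    (ϖ : Eˣ) (hϖ : ∃ h : (ϖ : E) ∈ 𝒪[E], 𝓂[E] = Ideal.span {⟨(ϖ : E), h⟩}) :
    ENat.card (R.LatticeQuotient ϖ) =
      ((∑ j ∈ Finset.range (R.levelIndex t + 1), (R.levelUnits ht.mem_integer j).index : ℕ) :
        ℕ∞) := by
  obtain ⟨hm, hϖ⟩ := hϖ
  have hϖ1 : valuation E (ϖ : E) < 1 := by
    have : (⟨ϖ, hm⟩ : 𝒪[E]) ∈ 𝓂[E] := hϖ ▸ Ideal.mem_span_singleton_self _
    exact (mem_maximalIdeal_iff_valuation_lt_one _).mp this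
  have hstab : ∀ (j : ℕ) (u : 𝒪[E]ˣ), unitsMap u • hR.levelIdeal t j = hR.levelIdeal t j ↔
      u ∈ R.levelUnits ht.mem_integer j := by
    intro j u
    rw [mem_levelUnits_iff]
    refine Subtype.ext_iff.trans ((units_smul_level_eq_iff ht.mem_integer _).trans ?_)
    rw [← map_inv]
    rfl
  let f : (Σ j : Fin (R.levelIndex t + 1), 𝒪[E]ˣ ⧸ R.levelUnits ht.mem_integer j) →
      R.LatticeQuotient ϖ := fun p => Quotient.liftOn' p.2
    (fun u => (Quotient.mk'' (unitsMap u • hR.levelIdeal t p.1) :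
      MulAction.orbitRel.Quotient (Subgroup.zpowers ϖ) R.FracIdeal)) (by
        intro u v huv
        rw [QuotientGroup.leftRel_apply, ← hstab] at huv
        congr 1
        rw [map_mul, mul_smul, map_inv, inv_smul_eq_iff] at huv
        exact huv.symm)
  have hf : Function.Bijective f := by
    constructor
    · rintro ⟨i, a⟩ ⟨j, b⟩ hab
      induction a using Quotient.inductionOn' with | _ u
      induction b using Quotient.inductionOn' with | _ v
      obtain ⟨⟨_, k, rfl⟩, hk⟩ : unitsMap u • hR.levelIdeal t i ∈
          MulAction.orbit (Subgroup.zpowers ϖ) (unitsMap v • hR.levelIdeal t j) :=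
        Quotient.exact hab
      change ϖ ^ k • unitsMap v • hR.levelIdeal t j = unitsMap u • hR.levelIdeal t i at hk
      rw [smul_smul, eq_comm, hR.units_smul_levelIdeal_eq_iff ht (Nat.le_of_lt_succ i.2)
        (Nat.le_of_lt_succ j.2)] at hk
      obtain ⟨hij, hs⟩ := hk
      obtain rfl := Fin.ext hij
      have hle : ∀ w : Eˣ, w • hR.levelIdeal t i = hR.levelIdeal t i → valuation E (w : E) = 1 := by
        intro w hw
        have := (units_smul_level_eq_iff ht.mem_integer w).mp (congrArg Subtype.val hw)
        have h1 := level_le_integers ht.mem_integer this.1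
        have h2 := level_le_integers ht.mem_integer this.2
        rw [Valuation.mem_integer_iff] at h1 h2
        rw [Units.val_inv_eq_inv_val, map_inv₀] at h2
        exact le_antisymm h1 ((inv_le_one₀ (zero_lt_iff.mpr (by simp))).mp h2)
      have hval := hle _ hs
      -- A stabilizing element is a unit of 𝒪, so the power of the uniformizer in it is trivial.
      have hk0 : k = 0 := by
        rw [Units.val_mul, map_mul, valuation_unitsMap, mul_one, mul_inv_rev, Units.val_mul,
          map_mul, ← map_inv, valuation_unitsMap, one_mul, Units.val_inv_eq_inv_val, map_inv₀,
          inv_eq_one, Units.val_zpow_eq_zpow_val, map_zpow₀] at hval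
        by_contra hne
        have hpos : 0 < valuation E (ϖ : E) := zero_lt_iff.mpr (by simp)
        rcases lt_or_gt_of_ne hne with h | h
        · exact (one_lt_zpow_of_neg₀ hpos hϖ1 h).ne' hval
        · exact (zpow_lt_one₀ hpos hϖ1 h).ne hval
      rw [hk0, zpow_zero, one_mul, ← map_inv, ← map_mul, hstab] at hs
      have : (Quotient.mk'' u : 𝒪[E]ˣ ⧸ R.levelUnits ht.mem_integer i) = Quotient.mk'' v :=
        (QuotientGroup.eq.mpr hs).symm
      rw [this]
    · intro q
      induction q using Quotient.inductionOn' with | _ M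
      obtain ⟨x, j, hj, hM⟩ := ht.exists_eq_units_smul_level M
      obtain ⟨k, hk⟩ := exists_valuation_eq_zpow hm hϖ x.ne_zero
      obtain ⟨v, hv⟩ := exists_unitsMap_eq (u := ϖ ^ (-k) * x) (by
        rw [Units.val_mul, map_mul, hk, Units.val_zpow_eq_zpow_val, map_zpow₀, ← zpow_add₀ (by simp),
          neg_add_cancel, zpow_zero])
      refine ⟨⟨⟨j, Nat.lt_succ_of_le hj⟩, Quotient.mk'' v⟩, ?_⟩
      refine Quotient.sound' (s₁ := MulAction.orbitRel (Subgroup.zpowers ϖ) R.FracIdeal) ?_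
      refine ⟨⟨ϖ ^ (-k), -k, rfl⟩, ?_⟩
      change ϖ ^ (-k) • M = unitsMap v • hR.levelIdeal t j
      have hM' : M = x • hR.levelIdeal t j := Subtype.ext hM
      rw [hM', smul_smul, hv]
  -- An index of 0 would stand for an infinite quotient, so nonvanishing is what makes the count
  -- finite.
  have hcard : ∀ j : Fin (R.levelIndex t + 1),
      Finite (𝒪[E]ˣ ⧸ R.levelUnits ht.mem_integer j) := by
    intro j
    have : (R.levelUnits ht.mem_integer j).index ≠ 0 := by
      obtain ⟨j, hj⟩ := j
      cases j with
      | zero => rw [index_levelUnits_zero]; exact one_ne_zero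
      | succ j =>
        rw [ht.index_levelUnits_succ (Nat.le_of_lt_succ hj)]
        have := pow_pos (Nat.card_pos (α := ResidueField R)) (j + 1)
        omega
    exact Nat.finite_of_card_ne_zero this
  rw [← ENat.card_congr (Equiv.ofBijective f hf), ENat.card_eq_coe_natCard, Nat.card_sigma,
    ← Fin.sum_univ_eq_sum_range fun j => (R.levelUnits ht.mem_integer j).index]
  rfl

end LocalOrder

end

end BassOrder

/-! ### Residue generators, approximation and unramified subfields. -/

namespace BassOrder

open IsLocalRing Polynomial

/-- Finite fields are perfect, so the residue extension has a separable primitive element; r lifts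
it and g lifts its minimal polynomial. The clause on the derivative prepares Hensel's lemma, and the
last two say that the powers of r reduce to a basis. -/
theorem exists_monic_lift_of_residueField_generator {A B : Type*} [CommRing A] [IsLocalRing A]
    [CommRing B] [IsLocalRing B] (f : A →+* B) [IsLocalHom f] [Finite (ResidueField A)]
    [Finite (ResidueField B)] :
    ∃ (d : ℕ) (g : A[X]) (r : B), d = residueDegree f ∧ d ≠ 0 ∧ g.Monic ∧ g.natDegree = d ∧
      eval₂ f r g ∈ maximalIdeal B ∧ eval₂ f r (derivative g) ∉ maximalIdeal B ∧
      (∀ x : B, ∃ c : Fin d → A, x - ∑ i, f (c i) * r ^ (i : ℕ) ∈ maximalIdeal B) ∧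
      ∀ c : Fin d → A, ∑ i, f (c i) * r ^ (i : ℕ) ∈ maximalIdeal B →
        ∀ i, c i ∈ maximalIdeal A := by
  let := (ResidueField.map f).toAlgebra
  have halg : ∀ a : A, algebraMap (ResidueField A) (ResidueField B) (residue A a) =
      residue B (f a) := fun a => rfl
  have : Module.Finite (ResidueField A) (ResidueField B) := Module.Finite.of_finite
  let pb := Field.powerBasisOfFiniteOfSeparable (ResidueField A) (ResidueField B)
  obtain ⟨r, hr⟩ := residue_surjective pb.gen
  have hint : IsIntegral (ResidueField A) pb.gen := Algebra.IsIntegral.isIntegral _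
  have hlift : minpoly (ResidueField A) pb.gen ∈ lifts (residue A) :=
    (lifts_iff_coeff_lifts _).mpr fun n => residue_surjective _
  obtain ⟨g, hg, hgd, hgm⟩ := lifts_and_natDegree_eq_and_monic hlift (minpoly.monic hint)
  have heval : ∀ h : A[X], residue B (eval₂ f r h) = aeval pb.gen (h.map (residue A)) := by
    intro h
    rw [aeval_def, eval₂_map, ← hr, hom_eval₂]
    rfl
  have hsum : ∀ c : Fin pb.dim → A, residue B (∑ i, f (c i) * r ^ (i : ℕ)) =
      ∑ i, residue A (c i) • pb.basis i := by
    intro c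
    simp only [map_sum, map_mul, map_pow, hr, PowerBasis.coe_basis, Algebra.smul_def, halg]
  refine ⟨pb.dim, g, r, pb.finrank.symm, pb.dim_pos.ne', hgm, by rw [hgd, pb.natDegree_minpoly],
    ?_, ?_, fun x => ?_, fun c hc => ?_⟩
  · rw [← residue_eq_zero_iff, heval, hg, minpoly.aeval]
  · rw [← residue_eq_zero_iff, heval, ← derivative_map, hg]
    exact (Algebra.IsSeparable.isSeparable (ResidueField A) pb.gen).aeval_derivative_ne_zero
      (minpoly.aeval _ _)
  · choose c hc using fun i => residue_surjective (R := A) (pb.basis.repr (residue B x) i)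
    refine ⟨c, ?_⟩
    rw [← residue_eq_zero_iff, map_sub, hsum]
    simp only [hc]
    rw [pb.basis.sum_repr, sub_self]
  · rw [← residue_eq_zero_iff, hsum] at hc
    intro i
    rw [← residue_eq_zero_iff]
    exact Fintype.linearIndependent_iff.mp pb.basis.linearIndependent _ hc i

section

set_option linter.unusedSectionVars false

variable {F E : Type*} [Field F] [ValuativeRel F] [TopologicalSpace F]
  [IsNonarchimedeanLocalField F] [Field E] [ValuativeRel E] [TopologicalSpace E]
  [IsNonarchimedeanLocalField E] [Algebra F E] [ValuativeExtension F E]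

theorem residueImage_le_iff {S T : Subring E} : residueImage S ≤ residueImage T ↔
    ∀ s ∈ S, s ∈ 𝒪[E] → ∃ t ∈ T, t ∈ 𝒪[E] ∧ valuation E (s - t) < 1 := by
  have hres : ∀ x y : 𝒪[E], residue 𝒪[E] y = residue 𝒪[E] x ↔ valuation E ((x : E) - y) < 1 := by
    intro x y
    rw [eq_comm, ← sub_eq_zero, ← map_sub, residue_eq_zero_iff,
      mem_maximalIdeal_iff_valuation_lt_one]
    rfl
  constructor
  · intro h s hs hsO
    obtain ⟨t, htT, hst⟩ := h ⟨⟨s, hsO⟩, hs, rfl⟩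
    exact ⟨t, htT, t.2, (hres ⟨s, hsO⟩ t).mp hst⟩
  · rintro h _ ⟨s, hs, rfl⟩
    obtain ⟨t, htT, htO, hst⟩ := h s hs s.2
    exact ⟨⟨t, htO⟩, htT, (hres s ⟨t, htO⟩).mpr hst⟩

theorem valuation_sum_lt_one {ι : Type*} (s : Finset ι) {f : ι → E}
    (h : ∀ i ∈ s, valuation E (f i) < 1) : valuation E (∑ i ∈ s, f i) < 1 :=
  (valuation E).map_sum_lt one_ne_zero h

theorem valuation_sub_lt_one {x y z : E} (h1 : valuation E (x - y) < 1)
    (h2 : valuation E (y - z) < 1) : valuation E (x - z) < 1 := by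
  simpa using (valuation E).map_add_lt h1 h2

theorem algebraMap_mem_integer {a : F} (ha : a ∈ 𝒪[F]) : algebraMap F E a ∈ 𝒪[E] :=
  (algebraMap_mem_integer_iff a).mpr ha

theorem valuation_sum_sub_sum_lt_one {ι : Type*} [Fintype ι] {b b' : ι → E}
    (h : ∀ i, valuation E (b i - b' i) < 1) (c : ι → 𝒪[F]) :
    valuation E (∑ i, algebraMap F E (c i) * b i - ∑ i, algebraMap F E (c i) * b' i) < 1 := by
  rw [← Finset.sum_sub_distrib]
  refine valuation_sum_lt_one _ fun i _ => ?_
  rw [← mul_sub, mul_comm]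
  exact (valuation_mul_le (algebraMap_mem_integer (c i).2)).trans_lt (h i)

/-- The integral combinations of b form a continuous image of a compact set, hence a closed set. -/
theorem exists_eq_sum_of_forall_approx {ι : Type*} [Fintype ι] (b : ι → E) {π : E}
    (hπ : valuation E π < 1) {x : E}
    (h : ∀ N : ℕ, ∃ c : ι → 𝒪[F], ∃ y ∈ 𝒪[E], x = ∑ i, algebraMap F E (c i) * b i + π ^ N * y) :
    ∃ c : ι → 𝒪[F], x = ∑ i, algebraMap F E (c i) * b i := by
  have hc := continuous_algebraMap_field F E
  let _ := IsTopologicalAddGroup.rightUniformSpace E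
  have := isUniformAddGroup_of_addCommGroup (G := E)
  let g : (ι → F) → E := fun c => ∑ i, algebraMap F E (c i) * b i
  have hg : Continuous g := by fun_prop
  have hF : IsCompact (𝒪[F] : Set F) := IsNonarchimedeanLocalField.isCompact_closedBall F 1
  have hL : IsClosed (g '' Set.pi Set.univ fun _ => (𝒪[F] : Set F)) :=
    ((isCompact_univ_pi fun _ => hF).image hg).isClosed
  have hx : x ∈ closure (g '' Set.pi Set.univ fun _ => (𝒪[F] : Set F)) := by
    rw [mem_closure_iff_nhds]
    intro U hU
    have hU' : (fun z => x - z) ⁻¹' U ∈ nhds (0 : E) := by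
      refine (continuous_const.sub continuous_id).continuousAt.preimage_mem_nhds ?_
      simpa using hU
    obtain ⟨γ, hγ, hs⟩ := (IsValuativeTopology.hasBasis_nhds_zero' E).mem_iff.mp hU'
    obtain ⟨N, hN⟩ := exists_pow_lt₀ hπ (Units.mk0 γ hγ)
    obtain ⟨c, y, hy, hxy⟩ := h N
    refine ⟨x - π ^ N * y, hs ?_, fun i => c i, fun i _ => (c i).2, ?_⟩
    · refine (valuation_mul_le hy).trans_lt ?_
      simpa using hN
    · rw [hxy, add_sub_cancel_right]
  rw [hL.closure_eq] at hx
  obtain ⟨c, hcO, rfl⟩ := hx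
  exact ⟨fun i => ⟨c i, hcO i trivial⟩, rfl⟩

/-- Divide by a coefficient of largest valuation: one coefficient becomes 1, so independence modulo
𝔪 gives the scaled sum valuation 1. -/
theorem exists_valuation_sum_eq {ι : Type*} [Fintype ι] {b : ι → E} (hb : ∀ i, b i ∈ 𝒪[E])
    (hind : ∀ c : ι → 𝒪[F], valuation E (∑ i, algebraMap F E (c i) * b i) < 1 →
      ∀ i, valuation F (c i) < 1) {a : ι → F} (ha : a ≠ 0) :
    ∃ j, a j ≠ 0 ∧ (∀ i, valuation F (a i) ≤ valuation F (a j)) ∧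
      valuation E (∑ i, algebraMap F E (a i) * b i) = valuation E (algebraMap F E (a j)) := by
  obtain ⟨i₀, hi₀⟩ := Function.ne_iff.mp ha
  obtain ⟨j, -, hj⟩ := Finset.univ.exists_max_image (fun i => valuation F (a i))
    ⟨i₀, Finset.mem_univ _⟩
  have hj0 : a j ≠ 0 := by
    intro h
    have := hj i₀ (Finset.mem_univ _)
    rw [h, map_zero, le_zero_iff, map_eq_zero] at this
    exact hi₀ this
  have hmem : ∀ i, a i / a j ∈ 𝒪[F] := by
    intro i
    rw [Valuation.mem_integer_iff, map_div₀]
    exact div_le_one_of_le₀ (hj i (Finset.mem_univ _)) zero_le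
  refine ⟨j, hj0, fun i => hj i (Finset.mem_univ _), ?_⟩
  have h1 : valuation E (∑ i, algebraMap F E (a i / a j) * b i) = 1 := by
    refine le_antisymm (sum_mem (S := 𝒪[E]) fun i _ =>
      mul_mem (algebraMap_mem_integer (hmem i)) (hb i)) ?_
    by_contra! h
    have := hind (fun i => ⟨a i / a j, hmem i⟩) h j
    simp [div_self hj0] at this
  have h2 : ∑ i, algebraMap F E (a i) * b i =
      algebraMap F E (a j) * ∑ i, algebraMap F E (a i / a j) * b i := by
    rw [Finset.mul_sum]
    refine Finset.sum_congr rfl fun i _ => ?_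
    rw [← mul_assoc, ← map_mul, mul_div_cancel₀ _ hj0]
  rw [h2, map_mul, h1, mul_one]

section UnramifiedSubfield

variable {K : IntermediateField F E}

theorem mem_integersOf_iff {x : E} : x ∈ integersOf K ↔ x ∈ K ∧ x ∈ 𝒪[E] := Iff.rfl

variable {p : F} (hp0 : p ≠ 0) {hpm : p ∈ 𝒪[F]} (hp : 𝓂[F] = Ideal.span {⟨p, hpm⟩})

include hp0 hp

/-- A uniformizer of F remains one in K. -/
theorem IsUnramifiedSubfield.exists_eq_mul (hK : IsUnramifiedSubfield K) {x : E}
    (hx : x ∈ integersOf K) (hx1 : valuation E x < 1) :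
    ∃ y ∈ integersOf K, x = algebraMap F E p * y := by
  obtain ⟨a, ha⟩ := hK x hx.1
  rw [ha, valuation_algebraMap_lt_one_iff] at hx1
  have ham : (⟨a, hx1.le⟩ : 𝒪[F]) ∈ 𝓂[F] := (mem_maximalIdeal_iff_valuation_lt_one _).mpr hx1
  rw [hp, Ideal.mem_span_singleton'] at ham
  obtain ⟨a', ha'⟩ := ham
  have haa : (a' : F) * p = a := congrArg Subtype.val ha'
  have hpE : algebraMap F E p ≠ 0 := by simpa using hp0
  refine ⟨x / algebraMap F E p, ⟨K.div_mem hx.1 (K.algebraMap_mem p), ?_⟩, by field_simp⟩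
  change valuation E _ ≤ 1
  rw [map_div₀, ha, ← haa, map_mul, map_mul, mul_div_cancel_right₀ _ (by simpa using hp0)]
  exact algebraMap_mem_integer a'.2

/-- Successive approximation in powers of p. G is only a group stable under p, so it can be a
subring or an 𝔬-lattice. -/
theorem IsUnramifiedSubfield.exists_sub_eq_pow_mul (hK : IsUnramifiedSubfield K)
    {G : AddSubgroup E} (hG : ∀ x ∈ G, algebraMap F E p * x ∈ G)
    (h : ∀ x ∈ integersOf K, ∃ s ∈ G, s ∈ integersOf K ∧ valuation E (x - s) < 1) (N : ℕ) :
    ∀ x ∈ integersOf K, ∃ s ∈ G, ∃ y ∈ integersOf K, x = s + algebraMap F E p ^ N * y := by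
  have hGN : ∀ N, ∀ x ∈ G, algebraMap F E p ^ N * x ∈ G := by
    intro N
    induction N with
    | zero => simp
    | succ N ih => intro x hx; rw [pow_succ, mul_assoc]; exact ih _ (hG x hx)
  induction N with
  | zero => exact fun x hx => ⟨0, zero_mem _, x, hx, by simp⟩
  | succ N ih =>
    intro x hx
    obtain ⟨s, hs, y, hy, rfl⟩ := ih x hx
    obtain ⟨y', hy', hy'K, hlt⟩ := h y hy
    obtain ⟨z, hz, hyz⟩ := hK.exists_eq_mul hp0 hp (sub_mem hy hy'K) hlt
    refine ⟨s + algebraMap F E p ^ N * y', add_mem hs (hGN N _ hy'), z, hz, ?_⟩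
    rw [pow_succ, mul_assoc, ← hyz]
    ring

/-- With 𝔪^k = p^M 𝒪, the k-th power of |κ_E| works: it fixes residues, and k successive powers
refine a congruence modulo 𝔪 to one modulo 𝔪^(k+1). -/
theorem exists_sub_pow_eq (M : ℕ) : ∃ q : ℕ,
    (∀ x ∈ 𝒪[E], valuation E (x - x ^ q) < 1) ∧
    ∀ x ∈ 𝒪[E], ∀ s ∈ 𝒪[E], valuation E (x - s) < 1 →
      ∃ y ∈ 𝒪[E], x ^ q - s ^ q = algebraMap F E p ^ M * y := by
  have : Fintype 𝓀[E] := Fintype.ofFinite _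
  have hpE : algebraMap F E p ≠ 0 := by simpa using hp0
  obtain ⟨ϖ, hϖ⟩ := IsDiscreteValuationRing.exists_irreducible 𝒪[E]
  have hϖ' := (IsDiscreteValuationRing.irreducible_iff_uniformizer ϖ).mp hϖ
  let P : 𝒪[E] := ⟨algebraMap F E p, algebraMap_mem_integer hpm⟩
  obtain ⟨k, hk⟩ := IsDiscreteValuationRing.ideal_eq_span_pow_irreducible
    (s := Ideal.span {P ^ M}) (Ideal.span_singleton_eq_bot.not.mpr
      (pow_ne_zero _ fun h => hpE (congrArg Subtype.val h))) hϖ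
  rw [← Ideal.span_singleton_pow ϖ, ← hϖ'] at hk
  have hq : ((Fintype.card 𝓀[E] : ℕ) : 𝒪[E]) ∈ 𝓂[E] := by
    rw [← residue_eq_zero_iff, map_natCast, FiniteField.cast_card_eq_zero]
  refine ⟨Fintype.card 𝓀[E] ^ k, fun x hx => ?_, fun x hx s hs hxs => ?_⟩
  · have : (⟨x, hx⟩ - ⟨x, hx⟩ ^ (Fintype.card 𝓀[E] ^ k) : 𝒪[E]) ∈ 𝓂[E] := by
      rw [← residue_eq_zero_iff, map_sub, map_pow, FiniteField.pow_card_pow, sub_self]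
    exact (mem_maximalIdeal_iff_valuation_lt_one _).mp this
  · have hsub : (⟨x, hx⟩ - ⟨s, hs⟩ : 𝒪[E]) ∈ 𝓂[E] :=
      (mem_maximalIdeal_iff_valuation_lt_one _).mpr hxs
    have := Ideal.pow_le_pow_right (Nat.le_succ k) (pow_sub_pow_mem_pow 𝓂[E] _ hq hsub k)
    rw [← hk, Ideal.mem_span_singleton'] at this
    obtain ⟨y, hy⟩ := this
    refine ⟨y, y.2, ?_⟩
    rw [mul_comm]
    exact (congrArg Subtype.val hy).symm

theorem IsUnramifiedSubfield.integersOf_le (hK : IsUnramifiedSubfield K)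
    {S : Subring E} (hF : ∀ a ∈ 𝒪[F], algebraMap F E a ∈ S) {M : ℕ}
    (hM : ∀ y ∈ 𝒪[E], algebraMap F E p ^ M * y ∈ S)
    (hres : residueImage (integersOf K) ≤ residueImage S) : integersOf K ≤ S := by
  obtain ⟨q, hq1, hq2⟩ := exists_sub_pow_eq (E := E) hp0 hp M
  rw [residueImage_le_iff] at hres
  intro x hx
  obtain ⟨s, hs, y, hy, rfl⟩ := hK.exists_sub_eq_pow_mul hp0 hp (G := S.toAddSubgroup)
    (fun x hx => S.mul_mem (hF p hpm) hx) (fun x hx => by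
      obtain ⟨s, hs, hsO, hxs⟩ := hres x hx hx.2
      obtain ⟨y, hy, hxy⟩ := hq2 x hx.2 s hsO hxs
      -- The representative is x^q: it has the residue of x, and it differs from s^q in S by an
      -- element of p^M 𝒪 ⊆ S.
      refine ⟨x ^ q, ?_, pow_mem hx _, hq1 x hx.2⟩
      rw [sub_eq_iff_eq_add] at hxy
      rw [hxy]
      exact S.add_mem (hM y hy) (S.pow_mem hs q)) M x hx
  exact S.add_mem hs (hM y hy.2)

end UnramifiedSubfield

end

end BassOrder

/-! ### Existence, uniqueness and degree of the coefficient field. -/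

namespace BassOrder

open IsLocalRing Polynomial IntermediateField

section

set_option linter.unusedSectionVars false

variable {F E : Type*} [Field F] [ValuativeRel F] [TopologicalSpace F]
  [IsNonarchimedeanLocalField F] [Field E] [ValuativeRel E] [TopologicalSpace E]
  [IsNonarchimedeanLocalField E] [Algebra F E] [ValuativeExtension F E] [FiniteDimensional F E]

namespace LocalOrder

variable (R : LocalOrder F E)

theorem exists_powers_residue_basis : ∃ (g : 𝒪[F][X]) (r : E) (hr : r ∈ R.toSubalgebra),
    residueDegree (algebraMap 𝒪[F] R) ≠ 0 ∧ g.Monic ∧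
    g.natDegree = residueDegree (algebraMap 𝒪[F] R) ∧
    eval₂ (algebraMap 𝒪[F] R) ⟨r, hr⟩ g ∈ maximalIdeal R ∧
    eval₂ (algebraMap 𝒪[F] R) ⟨r, hr⟩ (derivative g) ∉ maximalIdeal R ∧
    (∀ x ∈ R.toSubalgebra, ∃ c : Fin (residueDegree (algebraMap 𝒪[F] R)) → 𝒪[F],
      valuation E (x - ∑ i, algebraMap F E (c i) * r ^ (i : ℕ)) < 1) ∧
    ∀ c : Fin (residueDegree (algebraMap 𝒪[F] R)) → 𝒪[F],
      valuation E (∑ i, algebraMap F E (c i) * r ^ (i : ℕ)) < 1 → ∀ i, valuation F (c i) < 1 := by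
  obtain ⟨d, g, r, hd, hd0, hg, hgd, h1, h2, h3, h4⟩ :=
    exists_monic_lift_of_residueField_generator (algebraMap 𝒪[F] R)
  subst hd
  have hval : ∀ c : Fin (residueDegree (algebraMap 𝒪[F] R)) → 𝒪[F],
      ((∑ i, algebraMap 𝒪[F] R (c i) * r ^ (i : ℕ) : R) : E) =
        ∑ i, algebraMap F E (c i) * (r : E) ^ (i : ℕ) := by
    intro c
    rw [AddSubmonoidClass.coe_finsetSum]
    rfl
  refine ⟨g, r, r.2, hd0, hg, hgd, h1, h2, fun x hx => ?_, fun c hc i => ?_⟩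
  · obtain ⟨c, hc⟩ := h3 ⟨x, hx⟩
    rw [R.mem_maximalIdeal_iff] at hc
    refine ⟨c, ?_⟩
    rw [← hval]
    exact hc
  · rw [← hval, ← R.mem_maximalIdeal_iff] at hc
    exact (mem_maximalIdeal_iff_valuation_lt_one _).mp (h4 c hc i)

end LocalOrder

variable {R : LocalOrder F E}

theorem IsCoefficientField.integersOf_le {K : IntermediateField F E}
    (hK : IsCoefficientField R K) : integersOf K ≤ R.toSubalgebra.toSubring := by
  obtain ⟨p, hp0, hp1, hpm, hp⟩ := exists_uniformizer F
  obtain ⟨M, hM⟩ := R.exists_pow_mul_mem ((valuation_algebraMap_lt_one_iff (E := E) p).mpr hp1)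
  exact hK.1.integersOf_le hp0 hp (fun a ha => R.algebraMap_mem ha) hM hK.2.le

/-- Lift the residues of the powers of r to the integers of K. Independence modulo 𝔪 is inherited;
spanning follows by successive approximation and compactness. -/
theorem IsCoefficientField.exists_basis {K : IntermediateField F E}
    (hK : IsCoefficientField R K) :
    ∃ b : Fin (residueDegree (algebraMap 𝒪[F] R)) → E, (∀ i, b i ∈ integersOf K) ∧
      (∀ c : Fin (residueDegree (algebraMap 𝒪[F] R)) → 𝒪[F],
        valuation E (∑ i, algebraMap F E (c i) * b i) < 1 → ∀ i, valuation F (c i) < 1) ∧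
      (∀ x ∈ integersOf K, ∃ c : Fin (residueDegree (algebraMap 𝒪[F] R)) → 𝒪[F],
        x = ∑ i, algebraMap F E (c i) * b i) := by
  obtain ⟨p, hp0, hp1, hpm, hp⟩ := exists_uniformizer F
  obtain ⟨g, r, hr, -, -, -, -, -, hspan, hind⟩ := R.exists_powers_residue_basis
  have h1 := residueImage_le_iff.mp hK.2.le
  have h2 := residueImage_le_iff.mp hK.2.ge
  choose b hbK hbO hb using fun i : Fin (residueDegree (algebraMap 𝒪[F] R)) =>
    h2 (r ^ (i : ℕ)) (pow_mem hr _) (pow_mem (R.le_integers _ hr) _)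
  have hsub := valuation_sum_sub_sum_lt_one (F := F) hb
  have hbmem : ∀ c : Fin (residueDegree (algebraMap 𝒪[F] R)) → 𝒪[F],
      ∑ i, algebraMap F E (c i) * b i ∈ integersOf K := fun c => sum_mem fun i _ =>
    mul_mem (mem_integersOf_iff.mpr ⟨K.algebraMap_mem _, algebraMap_mem_integer (c i).2⟩) (hbK i)
  refine ⟨b, hbK, fun c hc => hind c ?_, fun x hx => ?_⟩
  · simpa using (valuation E).map_add_lt (hsub c) hc
  · refine exists_eq_sum_of_forall_approx b
      ((valuation_algebraMap_lt_one_iff (E := E) p).mpr hp1) fun N => ?_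
    let G : AddSubgroup E :=
      { carrier := {x | ∃ c : Fin (residueDegree (algebraMap 𝒪[F] R)) → 𝒪[F],
          x = ∑ i, algebraMap F E (c i) * b i}
        zero_mem' := ⟨0, by simp⟩
        add_mem' := by
          rintro _ _ ⟨c, rfl⟩ ⟨c', rfl⟩
          exact ⟨c + c', by simp [add_mul, Finset.sum_add_distrib]⟩
        neg_mem' := by
          rintro _ ⟨c, rfl⟩
          exact ⟨-c, by simp⟩ }
    obtain ⟨s, ⟨c, rfl⟩, y, hy, hxy⟩ := hK.1.exists_sub_eq_pow_mul hp0 hp (G := G) (by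
        rintro _ ⟨c, rfl⟩
        refine ⟨fun i => ⟨p, hpm⟩ * c i, ?_⟩
        rw [Finset.mul_sum]
        refine Finset.sum_congr rfl fun i _ => ?_
        rw [Subring.coe_mul, map_mul, mul_assoc]) (by
        intro x hx
        obtain ⟨s, hs, hsO, hxs⟩ := h1 x hx hx.2
        obtain ⟨c, hc⟩ := hspan s hs
        exact ⟨_, ⟨c, rfl⟩, hbmem c,
          valuation_sub_lt_one (valuation_sub_lt_one hxs hc) (hsub c)⟩) N x hx
    exact ⟨c, y, hy.2, hxy⟩

theorem exists_pow_mul_mem_integer {p : F} (hp1 : valuation F p < 1) (x : E) :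
    ∃ N : ℕ, algebraMap F E p ^ N * x ∈ 𝒪[E] := by
  rcases eq_or_ne x 0 with rfl | hx
  · exact ⟨0, by simp⟩
  have hx' : (valuation E x)⁻¹ ≠ 0 := by simpa using hx
  obtain ⟨N, hN⟩ := exists_pow_lt₀ ((valuation_algebraMap_lt_one_iff (E := E) p).mpr hp1)
    (Units.mk0 _ hx')
  refine ⟨N, ?_⟩
  rw [Valuation.mem_integer_iff, map_mul, map_pow]
  have := mul_le_mul_left hN.le (valuation E x)
  rwa [Units.val_mk0, inv_mul_cancel₀ (by simpa using hx)] at this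

theorem IsCoefficientField.finrank_eq {K : IntermediateField F E}
    (hK : IsCoefficientField R K) :
    Module.finrank F K = residueDegree (algebraMap 𝒪[F] R) := by
  obtain ⟨p, hp0, hp1, hpm, hp⟩ := exists_uniformizer F
  obtain ⟨b, hbK, hind, hspan⟩ := hK.exists_basis
  have hpE : ∀ N : ℕ, algebraMap F E p ^ N ≠ 0 := fun N => pow_ne_zero _ (by simpa using hp0)
  let b' : Fin (residueDegree (algebraMap 𝒪[F] R)) → K := fun i => ⟨b i, (hbK i).1⟩
  have hval : ∀ a : Fin (residueDegree (algebraMap 𝒪[F] R)) → F,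
      ((∑ i, a i • b' i : K) : E) = ∑ i, algebraMap F E (a i) * b i := by
    intro a
    rw [AddSubmonoidClass.coe_finsetSum]
    exact Finset.sum_congr rfl fun i _ => Algebra.smul_def (a i) (b i)
  have hli : LinearIndependent F b' := by
    rw [Fintype.linearIndependent_iff]
    intro a ha
    by_contra! hne
    obtain ⟨i, hi⟩ := hne
    obtain ⟨j, hj0, -, hj⟩ := exists_valuation_sum_eq (fun i => (hbK i).2) hind
      (a := a) (fun h => hi (congrFun h i))
    rw [← hval, ha] at hj
    simp only [ZeroMemClass.coe_zero, map_zero] at hj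
    exact hj0 (by simpa using hj.symm)
  have hsp : ⊤ ≤ Submodule.span F (Set.range b') := by
    rintro ⟨x, hx⟩ -
    obtain ⟨N, hN⟩ := exists_pow_mul_mem_integer (E := E) hp1 x
    obtain ⟨c, hc⟩ := hspan _ (mem_integersOf_iff.mpr
      ⟨K.mul_mem (pow_mem (K.algebraMap_mem p) N) hx, hN⟩)
    have : (⟨x, hx⟩ : K) = ∑ i, ((p ^ N)⁻¹ * (c i : F)) • b' i := by
      apply Subtype.ext
      rw [hval]
      simp only [map_mul, map_inv₀, map_pow, mul_assoc]
      rw [← Finset.mul_sum, ← hc, inv_mul_cancel_left₀ (hpE N)]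
    rw [this]
    exact sum_mem fun i _ => Submodule.smul_mem _ _ (Submodule.subset_span ⟨i, rfl⟩)
  rw [Module.finrank_eq_card_basis (Module.Basis.mk hli hsp), Fintype.card_fin]

/-- The subring `S + c 𝒪[E]` of `E`. -/
def addMulIntegers (S : Subring E) (hS : ∀ x ∈ S, x ∈ 𝒪[E]) {c : E} (hc : c ∈ 𝒪[E]) :
    Subring E where
  carrier := {x | ∃ s ∈ S, ∃ y ∈ 𝒪[E], x = s + c * y}
  zero_mem' := ⟨0, zero_mem _, 0, zero_mem _, by simp⟩
  one_mem' := ⟨1, one_mem _, 0, zero_mem _, by simp⟩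
  add_mem' := by
    rintro _ _ ⟨s, hs, y, hy, rfl⟩ ⟨s', hs', y', hy', rfl⟩
    exact ⟨s + s', add_mem hs hs', y + y', add_mem hy hy', by ring⟩
  neg_mem' := by
    rintro _ ⟨s, hs, y, hy, rfl⟩
    exact ⟨-s, neg_mem hs, -y, neg_mem hy, by ring⟩
  mul_mem' := by
    rintro _ _ ⟨s, hs, y, hy, rfl⟩ ⟨s', hs', y', hy', rfl⟩
    refine ⟨s * s', mul_mem hs hs', s * y' + y * s' + c * y * y', add_mem (add_mem
      (mul_mem (hS _ hs) hy') (mul_mem hy (hS _ hs'))) (mul_mem (mul_mem hc hy) hy'), by ring⟩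

/-- The integers of K lie in 𝒪_L + p^N 𝒪 for every N, hence in 𝒪_L, which is compact as an 𝔬-span of
finitely many elements. Denominators are then cleared by powers of p. -/
theorem IsCoefficientField.le {K L : IntermediateField F E} (hK : IsCoefficientField R K)
    (hL : IsCoefficientField R L) : K ≤ L := by
  obtain ⟨p, hp0, hp1, hpm, hp⟩ := exists_uniformizer F
  have hpO : algebraMap F E p ∈ 𝒪[E] := algebraMap_mem_integer hpm
  obtain ⟨b, hbL, -, hspan⟩ := hL.exists_basis
  have hbmem : ∀ c : Fin (residueDegree (algebraMap 𝒪[F] R)) → 𝒪[F],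
      ∑ i, algebraMap F E (c i) * b i ∈ L := fun c => sum_mem fun i _ =>
    mul_mem (L.algebraMap_mem _) (hbL i).1
  have hint : ∀ x ∈ integersOf K, x ∈ L := by
    intro x hx
    have key : ∃ c : Fin (residueDegree (algebraMap 𝒪[F] R)) → 𝒪[F],
        x = ∑ i, algebraMap F E (c i) * b i := by
      refine exists_eq_sum_of_forall_approx b
        ((valuation_algebraMap_lt_one_iff (E := E) p).mpr hp1) fun N => ?_
      have hle : integersOf L ≤ addMulIntegers (integersOf L) (fun x hx => hx.2) (pow_mem hpO N) :=
        fun x hx => ⟨x, hx, 0, zero_mem _, by simp⟩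
      obtain ⟨s, hs, y, hy, hxy⟩ := hK.1.integersOf_le hp0 hp
        (S := addMulIntegers (integersOf L) (fun x hx => hx.2) (pow_mem hpO N))
        (fun a ha => hle ⟨L.algebraMap_mem a, algebraMap_mem_integer ha⟩) (M := N)
        (fun y hy => ⟨0, zero_mem _, y, hy, by simp⟩)
        ((hK.2.trans hL.2.symm).le.trans ((Subring.gc_map_comap _).monotone_l fun _ hz => hle hz)) hx
      obtain ⟨c, rfl⟩ := hspan s hs
      exact ⟨c, y, hy, hxy⟩
    obtain ⟨c, rfl⟩ := key
    exact hbmem c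
  intro x hx
  obtain ⟨N, hN⟩ := exists_pow_mul_mem_integer (E := E) hp1 x
  have h1 := hint _ (mem_integersOf_iff.mpr
      ⟨K.mul_mem (pow_mem (K.algebraMap_mem p) N) hx, hN⟩)
  have h2 := L.mul_mem (L.inv_mem (pow_mem (L.algebraMap_mem p) N)) h1
  rwa [inv_mul_cancel_left₀ (pow_ne_zero _ (by simpa using hp0))] at h2

theorem henselianRing_integers : HenselianRing 𝒪[E] 𝓂[E] := by
  let _ := IsTopologicalAddGroup.rightUniformSpace E
  have := isUniformAddGroup_of_addCommGroup (G := E)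
  infer_instance

variable (R) in
-- Hensel's lemma is applied in 𝒪, where the root θ congruent to r is found. Powers of θ below the
-- degree span F(θ) and are independent modulo 𝔪; so valuations in F(θ) are those of coefficients,
-- and replacing θ by r matches residues with those of R.
theorem exists_isCoefficientField : ∃ K : IntermediateField F E, IsCoefficientField R K := by
  obtain ⟨g, r, hr, hd0, hg, hgd, h1, h2, hspan, hind⟩ := R.exists_powers_residue_basis
  have hHens := henselianRing_integers (E := E)
  let φ : 𝒪[F] →+* 𝒪[E] := R.toIntegers.comp (algebraMap 𝒪[F] R)
  have heval : ∀ h : 𝒪[F][X], eval (R.toIntegers ⟨r, hr⟩) (h.map φ) =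
      R.toIntegers (eval₂ (algebraMap 𝒪[F] R) ⟨r, hr⟩ h) := by
    intro h
    rw [eval_map, hom_eval₂]
  have hloc : ∀ x : R, R.toIntegers x ∈ 𝓂[E] ↔ x ∈ maximalIdeal R := by
    intro x
    rw [R.mem_maximalIdeal_iff, mem_maximalIdeal_iff_valuation_lt_one]
    rfl
  obtain ⟨θ, hroot, hθr⟩ := hHens.is_henselian (g.map φ) (hg.map φ) (R.toIntegers ⟨r, hr⟩)
    (by rw [heval, hloc]; exact h1) (by
      rw [derivative_map, heval]
      refine IsUnit.map _ ?_
      rw [← not_not (a := IsUnit _), ← mem_nonunits_iff, ← mem_maximalIdeal, hloc]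
      exact h2)
  have hθr' : valuation E ((θ : E) - r) < 1 := (mem_maximalIdeal_iff_valuation_lt_one _).mp hθr
  let G : F[X] := g.map 𝒪[F].subtype
  have hG : G.Monic := hg.map _
  have hGd : G.natDegree = residueDegree (algebraMap 𝒪[F] R) := by
    rw [← hgd]
    exact hg.natDegree_map _
  have hGθ : aeval (θ : E) G = 0 := by
    have := congrArg 𝒪[E].subtype hroot
    rw [eval_map, hom_eval₂, map_zero] at this
    rw [aeval_def, eval₂_map]
    exact this
  have hθint : IsIntegral F (θ : E) := ⟨G, hG, hGθ⟩
  have hpow : ∀ i : Fin (residueDegree (algebraMap 𝒪[F] R)),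
      valuation E ((θ : E) ^ (i : ℕ) - r ^ (i : ℕ)) < 1 := by
    intro i
    obtain ⟨y, hy⟩ := sub_dvd_pow_sub_pow θ (R.toIntegers ⟨r, hr⟩) i
    have hy' : (θ : E) ^ (i : ℕ) - r ^ (i : ℕ) = ((θ : E) - r) * y := congrArg Subtype.val hy
    rw [hy']
    exact (valuation_mul_le y.2).trans_lt hθr'
  have hsub := valuation_sum_sub_sum_lt_one (F := F) hpow
  have hind' : ∀ c : Fin (residueDegree (algebraMap 𝒪[F] R)) → 𝒪[F],
      valuation E (∑ i, algebraMap F E (c i) * (θ : E) ^ (i : ℕ)) < 1 →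
        ∀ i, valuation F (c i) < 1 := by
    intro c hc
    refine hind c ?_
    rw [← (valuation E).map_neg] at hc
    have := (valuation E).map_add_lt (hsub c) hc
    rw [← (valuation E).map_neg]
    convert this using 2
    ring
  have hmem : ∀ x ∈ F⟮(θ : E)⟯, ∃ a : Fin (residueDegree (algebraMap 𝒪[F] R)) → F,
      x = ∑ i, algebraMap F E (a i) * (θ : E) ^ (i : ℕ) := by
    intro x hx
    rw [← IntermediateField.mem_toSubalgebra,
      IntermediateField.adjoin_simple_toSubalgebra_of_isAlgebraic hθint.isAlgebraic,
      Algebra.adjoin_singleton_eq_range_aeval] at hx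
    obtain ⟨h, rfl⟩ := hx
    -- Positivity of the residue degree excludes G = 1.
    have hdeg : (h %ₘ G).natDegree < residueDegree (algebraMap 𝒪[F] R) := by
      rw [← hGd]
      exact natDegree_modByMonic_lt _ hG fun h1 => hd0 (by rw [← hGd, h1, natDegree_one])
    refine ⟨fun i => (h %ₘ G).coeff i, ?_⟩
    have h3 : aeval (θ : E) h = aeval (θ : E) (h %ₘ G) := by
      conv_lhs => rw [← modByMonic_add_div h G]
      rw [map_add, map_mul, hGθ, zero_mul, add_zero]
    change aeval (θ : E) h = _
    rw [h3, aeval_eq_sum_range' hdeg, Fin.sum_univ_eq_sum_range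
      (fun i => algebraMap F E ((h %ₘ G).coeff i) * (θ : E) ^ i)]
    simp only [Algebra.smul_def]
  have hθO : ∀ i : Fin (residueDegree (algebraMap 𝒪[F] R)), (θ : E) ^ (i : ℕ) ∈ 𝒪[E] :=
    fun i => pow_mem θ.2 _
  refine ⟨F⟮(θ : E)⟯, fun x hx => ?_, le_antisymm ?_ ?_⟩
  · obtain ⟨a, rfl⟩ := hmem x hx
    by_cases ha : a = 0
    · exact ⟨0, by simp [ha]⟩
    obtain ⟨j, -, -, hj⟩ := exists_valuation_sum_eq hθO hind' ha
    exact ⟨a j, hj⟩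
  · rw [residueImage_le_iff]
    intro x hx hxO
    obtain ⟨a, rfl⟩ := hmem x hx.1
    have haO : ∀ i, a i ∈ 𝒪[F] := by
      by_cases ha : a = 0
      · simp [ha]
      obtain ⟨j, -, hle, hj⟩ := exists_valuation_sum_eq hθO hind' ha
      rw [Valuation.mem_integer_iff, hj, ← Valuation.mem_integer_iff,
        algebraMap_mem_integer_iff] at hxO
      exact fun i => show valuation F (a i) ≤ 1 from le_trans (hle i) hxO
    have hs : ∑ i : Fin (residueDegree (algebraMap 𝒪[F] R)), algebraMap F E (a i) * r ^ (i : ℕ) ∈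
        R.toSubalgebra := sum_mem fun i _ => mul_mem (R.algebraMap_mem (haO i)) (pow_mem hr _)
    exact ⟨_, hs, R.le_integers _ hs, hsub fun i => ⟨a i, haO i⟩⟩
  · rw [residueImage_le_iff]
    intro s hs hsO
    obtain ⟨c, hc⟩ := hspan s hs
    have hO : ∑ i, algebraMap F E (c i) * (θ : E) ^ (i : ℕ) ∈ 𝒪[E] := sum_mem fun i _ =>
      mul_mem (algebraMap_mem_integer (c i).2) (hθO i)
    refine ⟨_, ⟨sum_mem fun i _ => mul_mem (IntermediateField.algebraMap_mem _ _)
      (pow_mem (mem_adjoin_simple_self F (θ : E)) _), hO⟩, hO, ?_⟩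
    refine valuation_sub_lt_one hc ?_
    rw [← (valuation E).map_neg, neg_sub]
    exact hsub c

end

end BassOrder

/-! ### Serre invariants and overorders. -/

namespace BassOrder

open IsLocalRing

section

set_option linter.unusedSectionVars false

variable {F E : Type*} [Field F] [ValuativeRel F] [TopologicalSpace F]
  [IsNonarchimedeanLocalField F] [Field E] [ValuativeRel E] [TopologicalSpace E]
  [IsNonarchimedeanLocalField E] [Algebra F E] [ValuativeExtension F E] [FiniteDimensional F E]

variable {R : LocalOrder F E}

/-- The integers of K have the same residue field as R, so each composition factor κ_R has length 1
over them. -/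
theorem IsCoefficientField.serreInvariant_eq {K : IntermediateField F E}
    (hK : IsCoefficientField R K) {t : E} (ht : R.IsLevelParameter t)
    (hle : ∀ a : integersOf K, algebraMap (integersOf K) E a ∈ R.toSubalgebra) :
    serreInvariant (integersOf K) R hle = R.levelIndex t := by
  let f : integersOf K →+* R :=
    { toFun := fun x => ⟨x, hle x⟩
      map_one' := rfl
      map_mul' := fun _ _ => rfl
      map_zero' := rfl
      map_add' := fun _ _ => rfl }
  have hf : IsLocalHom f := by
    refine ⟨fun x hx => ?_⟩
    obtain ⟨y, hy⟩ := hx.exists_right_inv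
    have hxy : (x : E) * y = 1 := congrArg Subtype.val hy
    have hmem : (y : E) ∈ integersOf K := by
      refine mem_integersOf_iff.mpr ⟨?_, R.le_integers _ y.2⟩
      rw [eq_inv_of_mul_eq_one_right hxy]
      exact K.inv_mem x.2.1
    exact IsUnit.of_mul_eq_one ⟨y, hmem⟩ (Subtype.ext hxy)
  have := RingHom.domain_isLocalRing f
  let := f.toAlgebra
  have : IsScalarTower (integersOf K) R E := IsScalarTower.of_algebraMap_eq' rfl
  have : IsLocalHom (algebraMap (integersOf K) R) := hf
  have hsurj : Function.Surjective
      (algebraMap (ResidueField (integersOf K)) (ResidueField R)) := by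
    intro z
    obtain ⟨r, rfl⟩ := residue_surjective z
    obtain ⟨x, hx, -, hrx⟩ := residueImage_le_iff.mp hK.2.ge r r.2 (R.le_integers _ r.2)
    refine ⟨residue _ ⟨x, hx⟩, ?_⟩
    change residue R (f ⟨x, hx⟩) = _
    rw [eq_comm, ← sub_eq_zero, ← map_sub, residue_eq_zero_iff, R.mem_maximalIdeal_iff]
    exact hrx
  rw [ht.serreInvariant_eq, Module.length_eq_of_surjective (R := ResidueField R) hsurj,
    Module.length_eq_one, mul_one]

namespace LocalOrder

theorem IsLevelParameter.serreInvariant_base_eq {t : E} (ht : R.IsLevelParameter t) :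
    serreInvariant 𝒪[F] R R.toSubalgebra.algebraMap_mem =
      ((residueDegree (algebraMap 𝒪[F] R) * R.levelIndex t : ℕ) : ℕ∞) := by
  have : Module.Finite 𝓀[F] (ResidueField R) := Module.Finite.of_finite
  -- `residueDegree` carries its own algebra structure; the two degrees are compared by counting
  -- elements.
  have hd : Module.finrank 𝓀[F] (ResidueField R) = residueDegree (algebraMap 𝒪[F] R) := by
    have : Fintype (ResidueField R) := Fintype.ofFinite _
    have : Fintype 𝓀[F] := Fintype.ofFinite _
    have h1 := R.card_residueField_eq_pow
    have h2 := Module.card_eq_pow_finrank (K := 𝓀[F]) (V := ResidueField R)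
    rw [← Nat.card_eq_fintype_card, ← Nat.card_eq_fintype_card, h1] at h2
    exact (Nat.pow_right_injective (Finite.one_lt_card (α := 𝓀[F])) h2).symm
  rw [ht.serreInvariant_eq, Module.length_eq_finrank, hd, mul_comm]
  norm_cast

/-- An overorder is an R-module between R and 𝒪, hence R + t^j 𝒪 for some j. Here t^j 𝒪 lies in its
conductor, which in turn lies in the overorder. -/
theorem IsLevelParameter.eq_closure {t : E} (ht : R.IsLevelParameter t) {ϖ : E}
    (hϖ : ∃ h : ϖ ∈ 𝒪[E], 𝓂[E] = Ideal.span {⟨ϖ, h⟩}) (R' : LocalOrder F E)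
    (hRR' : R.toSubalgebra ≤ R'.toSubalgebra) :
    R'.toSubalgebra.toSubring = Subring.closure ((R.toSubalgebra : Set E) ∪
      {x : E | ∃ y ∈ 𝒪[E], x = ϖ ^ R'.conductorExponent * y}) := by
  obtain ⟨hm, hϖ⟩ := hϖ
  have hc : R'.conductor = Ideal.span {⟨ϖ, hm⟩ ^ R'.conductorExponent} := by
    rw [R'.conductor_eq_pow, hϖ, Ideal.span_singleton_pow]
  apply le_antisymm
  · let M : Submodule R E :=
      { carrier := R'.toSubalgebra
        zero_mem' := zero_mem _
        add_mem' := add_mem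
        smul_mem' := fun c x hx => mul_mem (hRR' c.2) hx }
    obtain ⟨j, -, hM⟩ := ht.exists_eq_level (M := M) (one_mem R'.toSubalgebra) R'.le_integers
    have hmem : ∀ x, x ∈ R'.toSubalgebra ↔ x ∈ R.level t j := fun x => by rw [← hM]; rfl
    intro x hx
    obtain ⟨r, hr, y, hy, rfl⟩ := (hmem x).mp hx
    refine add_mem (Subring.subset_closure (Or.inl hr)) (Subring.subset_closure (Or.inr ?_))
    have htj : (⟨t, ht.mem_integer⟩ ^ j : 𝒪[E]) ∈ R'.conductor := by
      rw [mem_conductor_iff]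
      exact fun b hb => (hmem _).mpr (pow_mul_mem_level hb t j)
    rw [hc, Ideal.mem_span_singleton'] at htj
    obtain ⟨z, hz⟩ := htj
    have hz' : (z : E) * ϖ ^ R'.conductorExponent = t ^ j := congrArg Subtype.val hz
    exact ⟨z * y, mul_mem z.2 hy, by rw [← hz']; ring⟩
  · rw [Subring.closure_le]
    rintro x (hx | ⟨y, hy, rfl⟩)
    · exact hRR' hx
    · have : (⟨ϖ, hm⟩ ^ R'.conductorExponent : 𝒪[E]) ∈ R'.conductor :=
        hc ▸ Ideal.mem_span_singleton_self _
      exact (R'.mem_conductor_iff _).mp this y hy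

end LocalOrder

end

end BassOrder

/-! ### The main theorem. -/

open BassOrder in
theorem theorem1p4 {F E : Type*}
    [Field F] [ValuativeRel F] [TopologicalSpace F] [IsNonarchimedeanLocalField F]
    [Field E] [ValuativeRel E] [TopologicalSpace E] [IsNonarchimedeanLocalField E]
    [Algebra F E] [ValuativeExtension F E] [FiniteDimensional F E]
    (R : LocalOrder F E) (hR : R.IsBass)
    (ϖ : Eˣ) (hϖ : ∃ h : (ϖ : E) ∈ 𝒪[E], 𝓂[E] = Ideal.span {⟨(ϖ : E), h⟩}) :
    (residueDegree R.toIntegers = 1 ∨ residueDegree R.toIntegers = 2) ∧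
    R.conductor = 𝓂[E] ^ R.conductorExponent ∧
    (∃! K : IntermediateField F E, IsCoefficientField R K) ∧
    (∀ K : IntermediateField F E, IsCoefficientField R K →
      Module.finrank F K = residueDegree (algebraMap 𝒪[F] R) ∧
      ∃ hK : ∀ a : integersOf K, algebraMap (integersOf K) E a ∈ R.toSubalgebra,
      ∃ S S_K : ℕ,
        serreInvariant 𝒪[F] R R.toSubalgebra.algebraMap_mem = S ∧
        serreInvariant (integersOf K) R hK = S_K ∧
        S = residueDegree (algebraMap 𝒪[F] R) * S_K ∧
        ENat.card (R.LatticeQuotient ϖ) =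
          ((Nat.card 𝓀[F] ^ S + residueDegree R.toIntegers *
            ∑ i ∈ Finset.range S_K,
              Nat.card 𝓀[F] ^ (i * residueDegree (algebraMap 𝒪[F] R)) : ℕ) : ℕ∞) ∧
        ENat.card R.IdealClassMonoid = ((S_K + 1 : ℕ) : ℕ∞) ∧
        (S_K + 1 : ℚ) = (residueDegree R.toIntegers : ℚ) * R.conductorExponent / 2 + 1) ∧
    ∀ R' : LocalOrder F E, R.toSubalgebra ≤ R'.toSubalgebra →
      R'.conductor = 𝓂[E] ^ R'.conductorExponent ∧
      R'.toSubalgebra.toSubring = Subring.closure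
        ((R.toSubalgebra : Set E) ∪
          {x : E | ∃ y ∈ 𝒪[E], x = (ϖ : E) ^ R'.conductorExponent * y}) := by
  obtain ⟨t, ht⟩ := hR.exists_isLevelParameter
  obtain ⟨K₀, hK₀⟩ := exists_isCoefficientField R
  refine ⟨ht.residueDegree_eq_one_or_two, R.conductor_eq_pow,
    ⟨K₀, hK₀, fun L hL => le_antisymm (hL.le hK₀) (hK₀.le hL)⟩, fun K hK => ⟨hK.finrank_eq,
      fun a => hK.integersOf_le a.2, residueDegree (algebraMap 𝒪[F] R) * R.levelIndex t,
      R.levelIndex t, ht.serreInvariant_base_eq, hK.serreInvariant_eq ht _, rfl, ?_,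
      hR.card_idealClassMonoid ht, ?_⟩,
    fun R' hRR' => ⟨R'.conductor_eq_pow, ht.eq_closure hϖ R' hRR'⟩⟩
  · rw [hR.card_latticeQuotient ht ϖ hϖ, ht.sum_index_levelUnits, R.card_residueField_eq_pow]
    simp only [← pow_mul, mul_comm]
  · have h : (residueDegree R.toIntegers : ℚ) * R.conductorExponent = 2 * R.levelIndex t := by
      exact_mod_cast ht.residueDegree_mul_conductorExponent
    rw [h]
    ring
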